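/- A tree is an ordered rooted tree in which every internal node has exactly two (ordered) children. A tree with $n$ internal nodes has $n+1$ leaves, numbered $1,\dots,n+1$ from left to right; its internal nodes are named $1,\dots,n$ in symmetric (in-order) order. A right rotation at a node replaces the subtree $((A,B),C)$ rooted there by $(A,(B,C))$; a left rotation is the inverse operation. The rotation distance $d_R(S,T)$ of two trees with the same number of internal nodes is the minimum number of rotations that transform $S$ into $T$. An internal edge is an edge between two internal nodes; an internal edge of $S$ is common to $S$ and $T$ if some internal edge of $T$ separates the same set of leaves from the root. **Corollary.** There are a program $P$ for a random-access machine (registers and arrays of natural numbers; addition, truncated subtraction and comparison; each operation, memory access and test costs one step) and a constant $C$ such that for every $n \ge 1$ and all trees $S$ and $T$ with $n$ internal nodes the following holds. Given $n$, the roots of $S$ and $T$ and the tables of the left and right children of the nodes of $S$ and of $T$, the program $P$ halts after at most $Cn$ steps, with no stored number exceeding $Cn$, and outputs 1. the number $v = n-e-1$, where $e$ is the number of common edges of $S$ and $T$; this number is a $2$-approximation of the rotation distance in the sense that $v \le d_R(S,T) \le 2v$; 2. a sequence of at most $2v$ rotations (each given by its direction and the name of the node at which it is made) which, carried out in order, transforms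 $S$ into $T$. -/

import Mathlib

namespace RotDist

/-! ### Trees, rotations, rotation distance

An ordered rooted tree in which every internal node has two children is a `BinaryTree Unit`
(`nil` is a leaf, `node () l r` an internal node); `numNodes` is the number of internal nodes
and `numLeaves` the number of leaves. The internal nodes are named `1, …, n` in left-to-right
(symmetric) order: these are the keys of a binary search tree, and rotations preserve them.
The leaves are numbered `1, …, n + 1` from left to right. -/

abbrev BTree : Type := BinaryTree Unit

/-- The two directions of a rotation. -/
inductive Dir where
  | left
  | right
  deriving DecidableEq

/-- Rotation at the root. Right: the right child of the left child of the root becomes the left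
subtree of the root, which moves down to the right. Left: the inverse operation. The result is
`none` if the required child is not an internal node. -/
def rotateRoot : Dir → BTree → Option BTree
  | .right, .node _ (.node _ a b) c => some (.node () a (.node () b c))
  | .left, .node _ a (.node _ b c) => some (.node () (.node () a b) c)
  | _, _ => none

/-- Rotation in direction `d` at the node with key `k`;
`none` if there is no such node or it cannot be rotated in that direction. -/
def rotateAt (d : Dir) : ℕ → BTree → Option BTree
  | _, .nil => none
  | k, .node _ l r =>
    if k = l.numNodes + 1 then rotateRoot d (.node () l r)
    else if k < l.numNodes + 1 then (rotateAt d k l).map fun l' => .node () l' r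
    else (rotateAt d (k - (l.numNodes + 1)) r).map fun r' => .node () l r'

/-- A rotation: the direction, and the key of the node at which to rotate. -/
structure Rotation where
  dir : Dir
  key : ℕ
  deriving DecidableEq

/-- Carry out a sequence of rotations, first to last; `none` if one of them is impossible. -/
def applyRotations : List Rotation → BTree → Option BTree
  | [], t => some t
  | ρ :: l, t => (rotateAt ρ.dir ρ.key t).bind (applyRotations l)

/-- The rotation distance: the least length of a sequence of rotations from `S` to `T`
(`⊤` if there is none). -/
noncomputable def rotationDist (S T : BTree) : ℕ∞ :=
  ⨅ l : {l : List Rotation // applyRotations l S = some T}, (l.1.length : ℕ∞)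

/-! ### Common edges -/

/-- The sets of leaves below the internal nodes of a tree (its root included), when the leaves of
the tree are numbered `off + 1, …, off + t.numLeaves`. -/
def nodeLeafSets : ℕ → BTree → Finset (Finset ℕ)
  | _, .nil => ∅
  | off, .node _ l r =>
    insert (Finset.Icc (off + 1) (off + (l.numLeaves + r.numLeaves)))
      (nodeLeafSets off l ∪ nodeLeafSets (off + l.numLeaves) r)

/-- The internal edges of a tree (edges between two internal nodes), each given by the set of
leaves it separates from the root. Each internal node other than the root is the lower end of
exactly one internal edge, and different internal nodes have different sets of leaves below. -/
def internalEdges : BTree → Finset (Finset ℕ)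
  | .nil => ∅
  | .node _ l r => nodeLeafSets 0 l ∪ nodeLeafSets l.numLeaves r

/-- The number of common edges of `S` and `T`. -/
def numCommonEdges (S T : BTree) : ℕ := (internalEdges S ∩ internalEdges T).card

/-! ### A random-access machine with a step count

The store has scalar variables and arrays, all holding natural numbers. A program is a fixed
command, so it names only finitely many variables and arrays. Each operation, each memory access
and each test costs one step. No stored number and no address written to may exceed the word
bound `B`: an execution that would do so gets stuck. -/

structure Store where
  var : ℕ → ℕ
  arr : ℕ → ℕ → ℕ

inductive Expr where
  | const (c : ℕ)
  | var (x : ℕ)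
  | get (a : ℕ) (i : Expr)
  | add (e f : Expr)
  | sub (e f : Expr)
  | lt (e f : Expr)
  | eq (e f : Expr)

namespace Expr

/-- `sub` is truncated subtraction, and comparisons return `1` for true, `0` for false. -/
def eval (s : Store) : Expr → ℕ
  | const c => c
  | var x => s.var x
  | get a i => s.arr a (i.eval s)
  | add e f => e.eval s + f.eval s
  | sub e f => e.eval s - f.eval s
  | lt e f => if e.eval s < f.eval s then 1 else 0
  | eq e f => if e.eval s = f.eval s then 1 else 0

/-- The number of steps for evaluating an expression. -/
def cost : Expr → ℕ
  | const _ => 1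
  | var _ => 1
  | get _ i => i.cost + 1
  | add e f => e.cost + f.cost + 1
  | sub e f => e.cost + f.cost + 1
  | lt e f => e.cost + f.cost + 1
  | eq e f => e.cost + f.cost + 1

end Expr

/-- Programs. Conditions hold when their value is not `0`. -/
inductive Cmd where
  | skip
  | set (x : ℕ) (e : Expr)
  | put (a : ℕ) (i e : Expr)
  | seq (c d : Cmd)
  | ite (e : Expr) (c d : Cmd)
  | while (e : Expr) (c : Cmd)

def Store.setVar (s : Store) (x v : ℕ) : Store :=
  { s with var := Function.update s.var x v }

def Store.setArr (s : Store) (a i v : ℕ) : Store :=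
  { s with arr := Function.update s.arr a (Function.update (s.arr a) i v) }

/-- `Exec B c s t s'`: with word bound `B`, the command `c` started in the store `s` halts
after `t` steps in the store `s'`. -/
inductive Exec (B : ℕ) : Cmd → Store → ℕ → Store → Prop where
  | skip (s : Store) : Exec B .skip s 1 s
  | set (s : Store) (x : ℕ) (e : Expr) (h : e.eval s ≤ B) :
      Exec B (.set x e) s (e.cost + 1) (s.setVar x (e.eval s))
  | put (s : Store) (a : ℕ) (i e : Expr) (hi : i.eval s ≤ B) (he : e.eval s ≤ B) :
      Exec B (.put a i e) s (i.cost + e.cost + 1) (s.setArr a (i.eval s) (e.eval s))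
  | seq {c d : Cmd} {s s₁ s₂ : Store} {t u : ℕ}
      (hc : Exec B c s t s₁) (hd : Exec B d s₁ u s₂) : Exec B (.seq c d) s (t + u) s₂
  | ite_true {e : Expr} {c d : Cmd} {s s₁ : Store} {t : ℕ}
      (h : e.eval s ≠ 0) (hc : Exec B c s t s₁) : Exec B (.ite e c d) s (e.cost + 1 + t) s₁
  | ite_false {e : Expr} {c d : Cmd} {s s₁ : Store} {t : ℕ}
      (h : e.eval s = 0) (hd : Exec B d s t s₁) : Exec B (.ite e c d) s (e.cost + 1 + t) s₁
  | while_true {e : Expr} {c : Cmd} {s s₁ s₂ : Store} {t u : ℕ}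
      (h : e.eval s ≠ 0) (hc : Exec B c s t s₁) (hw : Exec B (.while e c) s₁ u s₂) :
      Exec B (.while e c) s (e.cost + 1 + t + u) s₂
  | while_false {e : Expr} {c : Cmd} {s : Store}
      (h : e.eval s = 0) : Exec B (.while e c) s (e.cost + 1) s

/-! ### Input and output

A tree is given in the usual linked form: the key of the root, and for each key the keys of the
left and of the right child, where `0` stands for a leaf. -/

/-- The key of the root of a subtree with keys `off + 1, …, off + t.numNodes`
(`0` for a leaf). -/
def rootKey (off : ℕ) : BTree → ℕ
  | .nil => 0
  | .node _ l _ => off + l.numNodes + 1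

/-- The key of the left child of the node with key `k` in a subtree with keys
`off + 1, …, off + t.numNodes` (`0` if that child is a leaf or there is no such node). -/
def leftChild : ℕ → BTree → ℕ → ℕ
  | _, .nil, _ => 0
  | off, .node _ l r, k =>
    if k = off + l.numNodes + 1 then rootKey off l
    else if k < off + l.numNodes + 1 then leftChild off l k
    else leftChild (off + l.numNodes + 1) r k

/-- The same for the right child. -/
def rightChild : ℕ → BTree → ℕ → ℕ
  | _, .nil, _ => 0
  | off, .node _ l r, k =>
    if k = off + l.numNodes + 1 then rootKey (off + l.numNodes + 1) r
    else if k < off + l.numNodes + 1 then rightChild off l k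
    else rightChild (off + l.numNodes + 1) r k

/-- The input: variable `0` holds the number of internal nodes, variables `1` and `2` the roots
of `S` and `T`, arrays `0` and `1` the left and right children in `S`, arrays `2` and `3` those
in `T`. The rest of the store is `0`. -/
def inputStore (S T : BTree) : Store where
  var
    | 0 => S.numNodes
    | 1 => rootKey 0 S
    | 2 => rootKey 0 T
    | _ => 0
  arr
    | 0 => leftChild 0 S
    | 1 => rightChild 0 S
    | 2 => leftChild 0 T
    | 3 => rightChild 0 T
    | _ => fun _ => 0

/-- The output number is in variable `3`. -/
def outputValue (s : Store) : ℕ := s.var 3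

/-- The output sequence of rotations: its length is in variable `4`, the directions
(`0` left, anything else right) are in array `4` and the keys in array `5`. -/
def outputRotations (s : Store) : List Rotation :=
  (List.range (s.var 4)).map fun j =>
    { dir := if s.arr 4 j = 0 then .left else .right, key := s.arr 5 j }

end RotDist

namespace RotDist

/-! ### Key intervals of nodes -/

/-! Identify an internal node with the interval of keys in its subtree. A tree with `n` nodes has
`n` such intervals, and the common edges are the common intervals other than that of the root. A
rotation destroys only one interval, so a path from `S` to `T` has at least as many rotations as
there are intervals of `S` missing from `T`, which is `n - (e + 1) = v` (`card_spans_sdiff_le`,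
`le_rotationDist`).

For the upper bound both trees are combed to the right while the set `E` of common non-root
intervals is kept. The nodes `p` are visited in decreasing key order; right rotations at `p` lift
over it the nodes on the right spine of its left subtree, down to the first node in `E`. In the
result every internal left child lies in `E` (`leftIn_comb`), and the intervals in `E` are still
present (`spans_comb`). These two properties determine the tree (`eq_of_leftIn`), so `S` and `T`
have the same combed form. Nodes outside `E` are lifted at most once and the root never, so each
tree needs at most `v` lifts (`length_lifts_le`). Combing `S` and then undoing the combing of `T`
gives at most `2v` rotations.

The program runs in linear time because it carries out no rotation: the chains of lifted nodes are
read off the input trees. Membership in `E` is tested in constant time, since an interval `[a, b]`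
other than the whole belongs to a tree iff it is that of the left child of `b + 1` or of the right
child of `a - 1` (`mem_spans_iff_first_or_last`). The loops scan the keys in order, so a subtree
corresponds to a block of consecutive iterations and their correctness is an induction on the tree
(`iters_firstBody`, `iters_lastBody`, `iters_body`). -/

/-- The key intervals (first and last key) of the subtrees rooted at the internal nodes of a tree
with keys `off + 1, …, off + t.numNodes`. -/
def spans : ℕ → BTree → Finset (ℕ × ℕ)
  | _, .nil => ∅
  | off, .node _ l r =>
    insert (off + 1, off + l.numNodes + r.numNodes + 1)
      (spans off l ∪ spans (off + l.numNodes + 1) r)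

/-- The leaves below a node with the given key interval. -/
def leavesOf (q : ℕ × ℕ) : Finset ℕ := Finset.Icc q.1 (q.2 + 1)

theorem mem_spans_node {off : ℕ} {u : Unit} {l r : BTree} {q : ℕ × ℕ} :
    q ∈ spans off (.node u l r) ↔ q = (off + 1, off + l.numNodes + r.numNodes + 1) ∨
      q ∈ spans off l ∨ q ∈ spans (off + l.numNodes + 1) r := by
  simp [spans]

theorem spans_bounds {t : BTree} {off : ℕ} {q : ℕ × ℕ} (h : q ∈ spans off t) :
    off < q.1 ∧ q.1 ≤ q.2 ∧ q.2 ≤ off + t.numNodes := by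
  induction t generalizing off with
  | nil => simp [spans] at h
  | node u l r ihl ihr =>
    rw [mem_spans_node] at h
    simp only [BinaryTree.numNodes]
    rcases h with h | h | h
    · subst h; refine ⟨?_, ?_, ?_⟩ <;> dsimp only <;> omega
    · have := ihl h; omega
    · have := ihr h; omega

theorem root_mem_spans {off : ℕ} {u : Unit} {l r : BTree} :
    (off + 1, off + l.numNodes + r.numNodes + 1) ∈ spans off (.node u l r) :=
  mem_spans_node.2 (Or.inl rfl)

theorem root_notMem_spans_left {off : ℕ} {l r : BTree} :
    (off + 1, off + l.numNodes + r.numNodes + 1) ∉ spans off l := by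
  intro h
  have := spans_bounds h
  dsimp only at this; omega

theorem root_notMem_spans_right {off : ℕ} {l r : BTree} :
    (off + 1, off + l.numNodes + r.numNodes + 1) ∉ spans (off + l.numNodes + 1) r := by
  intro h
  have := spans_bounds h
  dsimp only at this; omega

theorem disjoint_spans (off : ℕ) (l r : BTree) :
    Disjoint (spans off l) (spans (off + l.numNodes + 1) r) := by
  rw [Finset.disjoint_left]
  intro q h h'
  have := spans_bounds h
  have := spans_bounds h'
  omega

theorem card_spans (off : ℕ) (t : BTree) : (spans off t).card = t.numNodes := by
  induction t generalizing off with
  | nil => simp [spans]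
  | node u l r ihl ihr =>
    rw [spans, Finset.card_insert_of_notMem, Finset.card_union_of_disjoint (disjoint_spans _ _ _),
      ihl, ihr]
    · rfl
    · rw [Finset.mem_union, not_or]
      exact ⟨root_notMem_spans_left, root_notMem_spans_right⟩

theorem leavesOf_injOn : Set.InjOn leavesOf {q | q.1 ≤ q.2} := by
  rintro ⟨a, b⟩ hab ⟨c, d⟩ hcd h
  simp only [Set.mem_ofPred_eq] at hab hcd
  simp only [leavesOf] at h
  have h1 : Finset.Icc a (b + 1) ⊆ Finset.Icc c (d + 1) := h.subset
  have h2 : Finset.Icc c (d + 1) ⊆ Finset.Icc a (b + 1) := h.symm.subset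
  rw [Finset.Icc_subset_Icc_iff (by omega)] at h1 h2
  ext <;> dsimp only <;> omega

theorem nodeLeafSets_eq_image (off : ℕ) (t : BTree) :
    nodeLeafSets off t = (spans off t).image leavesOf := by
  induction t generalizing off with
  | nil => simp [spans, nodeLeafSets]
  | node u l r ihl ihr =>
    simp only [spans, nodeLeafSets, Finset.image_insert, Finset.image_union, ihl, ihr, leavesOf,
      BinaryTree.numLeaves_eq_numNodes_succ]
    congr 2
    ring

/-- Every internal node but the root is the lower end of an edge, and the interval of the root
occurs in neither subtree, so erasing it removes only the root. -/
theorem internalEdges_eq_image (t : BTree) :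
    internalEdges t = ((spans 0 t).erase (1, t.numNodes)).image leavesOf := by
  cases t with
  | nil => simp [spans, internalEdges]
  | node u l r =>
    have h : (spans 0 (.node u l r)).erase (1, (BinaryTree.node u l r).numNodes) =
        spans 0 l ∪ spans (0 + l.numNodes + 1) r := by
      rw [spans]
      simp only [BinaryTree.numNodes, zero_add]
      have h1 := root_notMem_spans_left (off := 0) (l := l) (r := r)
      have h2 := root_notMem_spans_right (off := 0) (l := l) (r := r)
      simp only [zero_add] at h1 h2
      rw [Finset.erase_insert]
      simp [h1, h2]
    rw [h, internalEdges, Finset.image_union, nodeLeafSets_eq_image, nodeLeafSets_eq_image,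
      BinaryTree.numLeaves_eq_numNodes_succ, zero_add]

/-- The key intervals below the common edges of two trees. -/
def commonSpans (S T : BTree) : Finset (ℕ × ℕ) :=
  (spans 0 S ∩ spans 0 T).erase (1, S.numNodes)

theorem numCommonEdges_eq (S T : BTree) (h : S.numNodes = T.numNodes) :
    numCommonEdges S T = (commonSpans S T).card := by
  rw [numCommonEdges, internalEdges_eq_image, internalEdges_eq_image, ← h,
    ← Finset.image_inter_of_injOn, Finset.card_image_of_injOn]
  · congr 1
    ext q
    simp only [commonSpans, Finset.mem_inter, Finset.mem_erase]
    tauto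
  · refine leavesOf_injOn.mono fun q hq => ?_
    simp only [Finset.coe_inter, Set.mem_inter_iff, Finset.mem_coe, Finset.mem_erase] at hq
    exact (spans_bounds hq.1.2).2.1
  · refine leavesOf_injOn.mono fun q hq => ?_
    simp only [Set.mem_union, Finset.mem_coe, Finset.mem_erase] at hq
    rcases hq with hq | hq
    · exact (spans_bounds hq.2).2.1
    · exact (spans_bounds hq.2).2.1

theorem root_mem_spans_zero {t : BTree} (h : 1 ≤ t.numNodes) : (1, t.numNodes) ∈ spans 0 t := by
  cases t with
  | nil => simp at h
  | node u l r =>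
    have := root_mem_spans (off := 0) (u := u) (l := l) (r := r)
    simpa using this

theorem card_spans_inter (S T : BTree) (h : S.numNodes = T.numNodes) (h1 : 1 ≤ S.numNodes) :
    (spans 0 S ∩ spans 0 T).card = (commonSpans S T).card + 1 := by
  rw [commonSpans, Finset.card_erase_add_one]
  rw [Finset.mem_inter]
  exact ⟨root_mem_spans_zero h1, h ▸ root_mem_spans_zero (h ▸ h1)⟩

/-! ### The lower bound -/

theorem spans_rotateRoot {d : Dir} {t t' : BTree} (h : rotateRoot d t = some t') (off : ℕ) :
    t'.numNodes = t.numNodes ∧ ∃ q, spans off t ⊆ insert q (spans off t') := by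
  match d, t, h with
  | .right, .node _ (.node _ a b) c, h =>
    simp only [rotateRoot, Option.some.injEq] at h
    subst h
    refine ⟨by simp only [BinaryTree.numNodes]; omega,
      -- The only interval lost is that of the lower node `(A, B)`, which the rotation replaces by
      -- `(B, C)`; in the left rotation below it is the other way round.
      (off + 1, off + a.numNodes + b.numNodes + 1), fun q hq => ?_⟩
    simp only [Finset.mem_insert, mem_spans_node, BinaryTree.numNodes] at hq ⊢
    ring_nf at hq ⊢
    tauto
  | .left, .node _ a (.node _ b c), h =>
    simp only [rotateRoot, Option.some.injEq] at h
    subst h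
    refine ⟨by simp only [BinaryTree.numNodes]; omega,
      (off + a.numNodes + 2, off + a.numNodes + b.numNodes + c.numNodes + 2), fun q hq => ?_⟩
    simp only [Finset.mem_insert, mem_spans_node, BinaryTree.numNodes] at hq ⊢
    ring_nf at hq ⊢
    tauto

theorem spans_rotateAt {d : Dir} {t t' : BTree} {k : ℕ} (h : rotateAt d k t = some t') (off : ℕ) :
    t'.numNodes = t.numNodes ∧ ∃ q, spans off t ⊆ insert q (spans off t') := by
  induction t generalizing k off t' with
  | nil => simp [rotateAt] at h
  | node u l r ihl ihr =>
    rw [rotateAt] at h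
    split_ifs at h with h1 h2
    · exact spans_rotateRoot h off
    · simp only [Option.map_eq_some_iff] at h
      obtain ⟨l', hl, rfl⟩ := h
      obtain ⟨hn, q, hq⟩ := ihl hl off
      refine ⟨by simp [hn], q, fun p hp => ?_⟩
      have := @hq p
      simp only [Finset.mem_insert, mem_spans_node, hn] at hp this ⊢
      tauto
    · simp only [Option.map_eq_some_iff] at h
      obtain ⟨r', hr, rfl⟩ := h
      obtain ⟨hn, q, hq⟩ := ihr hr (off + l.numNodes + 1)
      refine ⟨by simp [hn], q, fun p hp => ?_⟩
      have := @hq p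
      simp only [Finset.mem_insert, mem_spans_node, hn] at hp this ⊢
      tauto

theorem card_spans_sdiff_le {L : List Rotation} {S T : BTree} (h : applyRotations L S = some T) :
    (spans 0 S \ spans 0 T).card ≤ L.length := by
  induction L generalizing S with
  | nil =>
    simp only [applyRotations, Option.some.injEq] at h
    simp [h]
  | cons ρ L ih =>
    simp only [applyRotations, Option.bind_eq_some_iff] at h
    obtain ⟨S', hS, hT⟩ := h
    obtain ⟨-, q, hq⟩ := spans_rotateAt hS 0
    have hsub : spans 0 S \ spans 0 T ⊆ insert q (spans 0 S' \ spans 0 T) := by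
      intro p hp
      have := @hq p
      simp only [Finset.mem_insert, Finset.mem_sdiff] at hp this ⊢
      tauto
    calc _ ≤ _ := Finset.card_le_card hsub
      _ ≤ _ := Finset.card_insert_le _ _
      _ ≤ _ := by simpa using ih hT

theorem le_rotationDist {S T : BTree} (h : S.numNodes = T.numNodes) (h1 : 1 ≤ S.numNodes) {v : ℕ}
    (hv : v + numCommonEdges S T + 1 = S.numNodes) : (v : ℕ∞) ≤ rotationDist S T := by
  refine le_iInf fun l => ?_
  have h2 := card_spans_sdiff_le l.2
  have h3 := Finset.card_sdiff_add_card_inter (spans 0 S) (spans 0 T)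
  rw [card_spans_inter S T h h1, card_spans, ← numCommonEdges_eq S T h] at h3
  exact_mod_cast (by omega : v ≤ l.1.length)

/-! ### Lifting a left child over its parent -/

/-- `Lift off (p, x) t t'`: in the tree `t` with keys `off + 1, …, off + t.numNodes` the node `x` is
the left child of `p`, and the right rotation at `p` yields `t'`. -/
inductive Lift : ℕ → ℕ × ℕ → BTree → BTree → Prop
  | root (off : ℕ) (a b c : BTree) :
      Lift off (off + a.numNodes + 1 + b.numNodes + 1, off + a.numNodes + 1)
        (.node () (.node () a b) c) (.node () a (.node () b c))
  | left {off : ℕ} {q : ℕ × ℕ} {l l' : BTree} (r : BTree) (h : Lift off q l l') :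
      Lift off q (.node () l r) (.node () l' r)
  | right {off : ℕ} {q : ℕ × ℕ} {r r' : BTree} (l : BTree)
      (h : Lift (off + l.numNodes + 1) q r r') : Lift off q (.node () l r) (.node () l r')

/-- In-order names survive a rotation, so the pair `(p, x)` records both the right rotation, made at
`p`, and its inverse, made at `x`. -/
theorem Lift.spec {off : ℕ} {q : ℕ × ℕ} {t t' : BTree} (h : Lift off q t t') :
    t'.numNodes = t.numNodes ∧ off < q.2 ∧ q.2 < q.1 ∧ q.1 ≤ off + t.numNodes ∧
      rotateAt .right (q.1 - off) t = some t' ∧ rotateAt .left (q.2 - off) t' = some t := by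
  induction h with
  | root off a b c =>
    refine ⟨by simp only [BinaryTree.numNodes]; omega, by dsimp only; omega, by dsimp only; omega,
      by simp only [BinaryTree.numNodes]; omega, ?_, ?_⟩
    · rw [rotateAt, if_pos (by simp only [BinaryTree.numNodes]; omega)]
      rfl
    · rw [rotateAt, if_pos (by dsimp only; omega)]
      rfl
  | @left off q l l' r h ih =>
    obtain ⟨h1, h2, h3, h4, h5, h6⟩ := ih
    refine ⟨by simp only [BinaryTree.numNodes]; omega, h2, h3,
      by simp only [BinaryTree.numNodes]; omega, ?_, ?_⟩
    · rw [rotateAt, if_neg (by omega), if_pos (by omega), h5]; rfl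
    · rw [rotateAt, if_neg (by omega), if_pos (by omega), h6]; rfl
  | @right off q r r' l h ih =>
    obtain ⟨h1, h2, h3, h4, h5, h6⟩ := ih
    refine ⟨by simp only [BinaryTree.numNodes]; omega, by omega, h3,
      by simp only [BinaryTree.numNodes]; omega, ?_, ?_⟩
    · rw [rotateAt, if_neg (by omega), if_neg (by omega),
        show q.1 - off - (l.numNodes + 1) = q.1 - (off + l.numNodes + 1) by omega, h5]
      rfl
    · rw [rotateAt, if_neg (by omega), if_neg (by omega),
        show q.2 - off - (l.numNodes + 1) = q.2 - (off + l.numNodes + 1) by omega, h6]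
      rfl

/-- A sequence of lifts. -/
inductive Lifts (off : ℕ) : List (ℕ × ℕ) → BTree → BTree → Prop
  | nil (t : BTree) : Lifts off [] t t
  | cons {q : ℕ × ℕ} {L : List (ℕ × ℕ)} {t t' t'' : BTree}
      (h : Lift off q t t') (hs : Lifts off L t' t'') : Lifts off (q :: L) t t''

namespace Lifts

theorem append {off : ℕ} {L M : List (ℕ × ℕ)} {t t' t'' : BTree} (h : Lifts off L t t')
    (h' : Lifts off M t' t'') : Lifts off (L ++ M) t t'' := by
  induction h with
  | nil t => exact h'
  | cons h _ ih => exact cons h (ih h')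

theorem left {off : ℕ} {L : List (ℕ × ℕ)} {l l' : BTree} (r : BTree) (h : Lifts off L l l') :
    Lifts off L (.node () l r) (.node () l' r) := by
  induction h with
  | nil t => exact nil _
  | cons h _ ih => exact cons (h.left r) ih

theorem right {off : ℕ} {L : List (ℕ × ℕ)} {r r' : BTree} (l : BTree)
    (h : Lifts (off + l.numNodes + 1) L r r') :
    Lifts off L (.node () l r) (.node () l r') := by
  induction h with
  | nil t => exact nil _
  | cons h _ ih => exact cons (h.right l) ih

end Lifts

theorem applyRotations_append (L M : List Rotation) (t : BTree) :
    applyRotations (L ++ M) t = (applyRotations L t).bind (applyRotations M) := by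
  induction L generalizing t with
  | nil => rfl
  | cons ρ L ih =>
    simp only [List.cons_append, applyRotations, Option.bind_assoc]
    congr 1
    funext x
    exact ih x

theorem Lifts.apply_right {L : List (ℕ × ℕ)} {t t' : BTree} (h : Lifts 0 L t t') :
    applyRotations (L.map fun q => ⟨.right, q.1⟩) t = some t' := by
  induction h with
  | nil t => rfl
  | cons h _ ih =>
    have := h.spec.2.2.2.2.1
    simp only [List.map_cons, applyRotations]
    rw [Nat.sub_zero] at this
    rw [this]
    exact ih

theorem Lifts.apply_left {L : List (ℕ × ℕ)} {t t' : BTree} (h : Lifts 0 L t t') :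
    applyRotations (L.reverse.map fun q => ⟨.left, q.2⟩) t' = some t := by
  induction h with
  | nil t => rfl
  | cons h _ ih =>
    have := h.spec.2.2.2.2.2
    simp only [List.reverse_cons, List.map_append, applyRotations_append, ih, List.map_cons,
      List.map_nil, Option.bind_some, applyRotations]
    rw [Nat.sub_zero] at this
    rw [this]
    rfl

/-! ### Combing a tree along a set of fixed nodes -/

section Comb

variable (E : Finset (ℕ × ℕ))

/-- The lifts over `p` of the nodes on the right spine of the left subtree of `p`, from the top
down to the first node in `E`. -/
def chain (p : ℕ) : ℕ → BTree → List (ℕ × ℕ)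
  | _, .nil => []
  | off, .node _ l r =>
    if (off + 1, off + l.numNodes + r.numNodes + 1) ∈ E then []
    else (p, off + l.numNodes + 1) :: chain p (off + l.numNodes + 1) r

/-- The lifts that comb a tree to the right without moving the nodes in `E`. -/
def lifts : ℕ → BTree → List (ℕ × ℕ)
  | _, .nil => []
  | off, .node _ l r =>
    lifts (off + l.numNodes + 1) r ++
      (chain E (off + l.numNodes + 1) off l ++ lifts off l)

/-- The result of lifting the chain of `t` over the node with left subtree `t` and right
subtree `w`. -/
def chainLifted (w : BTree) : ℕ → BTree → BTree
  | _, .nil => .node () .nil w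
  | off, .node _ l r =>
    if (off + 1, off + l.numNodes + r.numNodes + 1) ∈ E then .node () (.node () l r) w
    else .node () l (chainLifted w (off + l.numNodes + 1) r)

/-- The combed form of a tree `t`, or of the tree with left subtree `t` and right subtree `w`
when `w` is combed. -/
def comb : ℕ → BTree → Option BTree → BTree
  | _, .nil, none => .nil
  | _, .nil, some w => .node () .nil w
  | off, .node _ l r, none => comb off l (some (comb (off + l.numNodes + 1) r none))
  | off, .node _ l r, some w =>
    if (off + 1, off + l.numNodes + r.numNodes + 1) ∈ E then
      .node () (comb off l (some (comb (off + l.numNodes + 1) r none))) w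
    else comb off l (some (comb (off + l.numNodes + 1) r (some w)))

/-- When `x` has been lifted over `p`, the former right child of `x` is the left child of `p`. The
rest of the chain is therefore lifted over the same `p`, now inside the right subtree of `x`. -/
theorem lifts_chain (off : ℕ) (t w : BTree) :
    Lifts off (chain E (off + t.numNodes + 1) off t) (.node () t w) (chainLifted E w off t) := by
  induction t generalizing off with
  | nil => exact Lifts.nil _
  | node u l r ihl ihr =>
    rw [chain, chainLifted]
    split_ifs with h
    · exact Lifts.nil _
    · have h1 := Lift.root off l r w
      rw [show off + l.numNodes + 1 + r.numNodes + 1 =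
        off + (BinaryTree.node u l r).numNodes + 1 by simp only [BinaryTree.numNodes]; omega] at h1
      refine Lifts.cons h1 (Lifts.right _ ?_)
      have := ihr (off + l.numNodes + 1)
      rwa [show off + l.numNodes + 1 + r.numNodes + 1 =
        off + (BinaryTree.node u l r).numNodes + 1 by simp only [BinaryTree.numNodes]; omega]
        at this

/-- The second clause makes the induction go through: by the time the left subtree of a node is
combed, its chain has already been lifted over that node, and the same lifts must still apply to
this altered tree. -/
theorem lifts_comb (t : BTree) : ∀ off : ℕ,
    Lifts off (lifts E off t) t (comb E off t none) ∧
      ∀ w, Lifts off (lifts E off t) (chainLifted E w off t) (comb E off t (some w)) := by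
  induction t with
  | nil => exact fun off => ⟨Lifts.nil _, fun w => Lifts.nil _⟩
  | node u l r ihl ihr =>
    intro off
    have hn : Lifts off (lifts E off (.node u l r)) (.node u l r)
        (comb E off (.node u l r) none) :=
      ((ihr (off + l.numNodes + 1)).1.right l).append
        ((lifts_chain E off l _).append ((ihl off).2 _))
    refine ⟨hn, fun w => ?_⟩
    rw [chainLifted, comb]
    split_ifs with h
    · exact hn.left w
    · exact (((ihr (off + l.numNodes + 1)).2 w).right l).append
        ((lifts_chain E off l _).append ((ihl off).2 _))

theorem numNodes_comb (t : BTree) : ∀ off : ℕ,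
    (comb E off t none).numNodes = t.numNodes ∧
      ∀ w, (comb E off t (some w)).numNodes = t.numNodes + w.numNodes + 1 := by
  induction t with
  | nil => exact fun off => ⟨rfl, fun w => by simp [comb]⟩
  | node u l r ihl ihr =>
    intro off
    refine ⟨?_, fun w => ?_⟩
    · rw [comb, (ihl off).2, (ihr _).1]
      rfl
    · rw [comb]
      split_ifs
      · simp only [BinaryTree.numNodes]; rw [(ihl off).2, (ihr _).1]
      · simp only [BinaryTree.numNodes]; rw [(ihl off).2, (ihr _).2]; omega

/-! ### Properties of the combed form -/

/-- All left children that are internal nodes are in `E`. -/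
def LeftIn : ℕ → BTree → Prop
  | _, .nil => True
  | off, .node _ l r => (l = .nil ∨ (off + 1, off + l.numNodes) ∈ E) ∧
      LeftIn off l ∧ LeftIn (off + l.numNodes + 1) r

theorem leftIn_comb (t : BTree) : ∀ off : ℕ,
    LeftIn E off (comb E off t none) ∧
      ∀ w, LeftIn E (off + t.numNodes + 1) w → LeftIn E off (comb E off t (some w)) := by
  induction t with
  | nil =>
    refine fun off => ⟨trivial, fun w hw => ?_⟩
    exact ⟨Or.inl rfl, trivial, hw⟩
  | node u l r ihl ihr =>
    intro off
    have hn : LeftIn E off (comb E off (.node u l r) none) :=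
      (ihl off).2 _ (ihr _).1
    refine ⟨hn, fun w hw => ?_⟩
    have hw' : LeftIn E (off + l.numNodes + 1 + r.numNodes + 1) w := by
      rwa [show off + l.numNodes + 1 + r.numNodes + 1 =
        off + (BinaryTree.node u l r).numNodes + 1 by simp only [BinaryTree.numNodes]; omega]
    have hs := (numNodes_comb E (.node u l r) off).1
    rw [comb]
    split_ifs with h
    · rw [comb] at hs hn
      refine ⟨Or.inr ?_, hn, ?_⟩
      · rw [hs]
        simpa only [BinaryTree.numNodes, add_assoc] using h
      · rwa [hs]
    · exact (ihl off).2 _ ((ihr _).2 w hw')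

theorem spans_comb (t : BTree) : ∀ off : ℕ,
    (∀ q ∈ E, q ∈ spans off t → q ∈ spans off (comb E off t none)) ∧
      ∀ w, ∀ q ∈ E, (q ∈ spans off t ∨ q ∈ spans (off + t.numNodes + 1) w) →
        q ∈ spans off (comb E off t (some w)) := by
  induction t with
  | nil =>
    refine fun off => ⟨fun q _ h => h, fun w q _ h => ?_⟩
    rw [comb, mem_spans_node]
    exact Or.inr h
  | node u l r ihl ihr =>
    intro off
    have hs := (numNodes_comb E (.node u l r) off).1
    have hn : ∀ q ∈ E, q ∈ spans off (.node u l r) →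
        q ∈ spans off (comb E off (.node u l r) none) := by
      intro q hE hq
      rw [mem_spans_node] at hq
      rcases hq with hq | hq | hq
      -- The root interval depends only on `off` and the number of nodes, so it survives whatever
      -- the shape of the combed tree.
      · generalize comb E off (.node u l r) none = c at hs ⊢
        cases c with
        | nil => simp at hs
        | node u' l' r' =>
          rw [mem_spans_node, hq]
          left
          simp only [BinaryTree.numNodes] at hs
          congr 1
          omega
      · exact (ihl off).2 _ q hE (Or.inl hq)
      · exact (ihl off).2 _ q hE (Or.inr ((ihr _).1 q hE hq))
    refine ⟨hn, fun w q hE hq => ?_⟩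
    rw [comb]
    split_ifs with h
    · rw [mem_spans_node]
      rw [comb] at hs hn
      rw [hs]
      rcases hq with hq | hq
      · exact Or.inr (Or.inl (hn q hE hq))
      · exact Or.inr (Or.inr hq)
    · rw [mem_spans_node] at hq
      rcases hq with (hq | hq | hq) | hq
      · exact absurd (hq ▸ hE) h
      · exact (ihl off).2 _ q hE (Or.inl hq)
      · exact (ihl off).2 _ q hE (Or.inr ((ihr _).2 w q hE (Or.inl hq)))
      · refine (ihl off).2 _ q hE (Or.inr ((ihr _).2 w q hE (Or.inr ?_)))
        rwa [show off + l.numNodes + 1 + r.numNodes + 1 =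
          off + (BinaryTree.node u l r).numNodes + 1 by simp only [BinaryTree.numNodes]; omega]

/-- The lifts of a tree contain the chain of its left subtree but not that of its right subtree; the
latter continues the chain of the whole tree. Counting both lengths together lets each node outside
`E` be charged once. Equality can fail because a chain stops at its first node in `E`. -/
theorem length_lifts_add_length_chain_le (p off : ℕ) (t : BTree) :
    (lifts E off t).length + (chain E p off t).length ≤ (spans off t \ E).card := by
  induction t generalizing off p with
  | nil => simp [lifts, chain]
  | node u l r ihl ihr =>
    have h1 := ihl (off + l.numNodes + 1) off
    have h2 := ihr p (off + l.numNodes + 1)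
    have hd : Disjoint (spans off l \ E) (spans (off + l.numNodes + 1) r \ E) :=
      (disjoint_spans off l r).mono Finset.sdiff_subset Finset.sdiff_subset
    have hc := Finset.card_union_of_disjoint hd
    rw [← Finset.union_sdiff_distrib] at hc
    rw [lifts, chain, spans]
    split_ifs with h
    · rw [Finset.insert_sdiff_of_mem _ h, hc]
      simp only [List.length_append, List.length_nil]
      omega
    · rw [Finset.insert_sdiff_of_notMem _ h, Finset.card_insert_of_notMem, hc]
      · simp only [List.length_append, List.length_cons]
        omega
      · rw [Finset.mem_sdiff, Finset.mem_union]
        rintro ⟨h3 | h3, -⟩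
        · exact root_notMem_spans_left h3
        · exact root_notMem_spans_right h3

/-! ### Uniqueness of the combed form -/

/-- If `l` is not a leaf, its interval is in `E` and so occurs in the other tree. It starts at the
first key and is too short to be the whole interval, hence it lies in `l'`. By symmetry two combed
trees split at the same root key. -/
theorem numNodes_le_of_leftIn {off : ℕ} {u u' : Unit} {l r l' r' : BTree}
    (hn : (BinaryTree.node u l r).numNodes = (BinaryTree.node u' l' r').numNodes)
    (hl : l = .nil ∨ (off + 1, off + l.numNodes) ∈ E)
    (hE : ∀ q ∈ E, q ∈ spans off (.node u l r) → q ∈ spans off (.node u' l' r')) :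
    l.numNodes ≤ l'.numNodes := by
  rcases hl with rfl | hl
  · simp
  cases l with
  | nil => simp
  | node v a b =>
    have h0 : (off + 1, off + (BinaryTree.node v a b).numNodes) ∈ spans off (.node v a b) := by
      have := root_mem_spans (off := off) (u := v) (l := a) (r := b)
      simpa only [BinaryTree.numNodes, add_assoc] using this
    have h1 := hE _ hl (mem_spans_node.2 (Or.inr (Or.inl h0)))
    rw [mem_spans_node] at h1
    simp only [BinaryTree.numNodes] at hn
    rcases h1 with h1 | h1 | h1
    · simp only [Prod.mk.injEq, BinaryTree.numNodes] at h1
      omega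
    · have := spans_bounds h1
      dsimp only at this; omega
    · have := spans_bounds h1
      dsimp only at this; omega

theorem mem_spans_left {off : ℕ} {u : Unit} {l r : BTree} {q : ℕ × ℕ}
    (h : q ∈ spans off (.node u l r)) (hq : q.2 ≤ off + l.numNodes) : q ∈ spans off l := by
  rw [mem_spans_node] at h
  rcases h with h | h | h
  · subst h; dsimp only at hq; omega
  · exact h
  · have := spans_bounds h; omega

theorem mem_spans_right {off : ℕ} {u : Unit} {l r : BTree} {q : ℕ × ℕ}
    (h : q ∈ spans off (.node u l r)) (hq : off + l.numNodes + 1 < q.1) :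
    q ∈ spans (off + l.numNodes + 1) r := by
  rw [mem_spans_node] at h
  rcases h with h | h | h
  · subst h; dsimp only at hq; omega
  · have := spans_bounds h; omega
  · exact h

theorem eq_of_leftIn {X Y : BTree} {off : ℕ} (hn : X.numNodes = Y.numNodes)
    (hX : LeftIn E off X) (hY : LeftIn E off Y)
    (hE : ∀ q ∈ E, q ∈ spans off X ↔ q ∈ spans off Y) : X = Y := by
  induction X generalizing Y off with
  | nil =>
    cases Y with
    | nil => rfl
    | node u l r => simp at hn
  | node u l r ihl ihr =>
    cases Y with
    | nil => simp at hn
    | node u' l' r' =>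
      have hl : l.numNodes = l'.numNodes := le_antisymm
        (numNodes_le_of_leftIn E hn hX.1 fun q h => (hE q h).1)
        (numNodes_le_of_leftIn E hn.symm hY.1 fun q h => (hE q h).2)
      have hr : r.numNodes = r'.numNodes := by
        simp only [BinaryTree.numNodes] at hn; omega
      have h1 : l = l' := by
        refine ihl hl hX.2.1 hY.2.1 fun q hq => ⟨fun h => ?_, fun h => ?_⟩
        · exact mem_spans_left ((hE q hq).1 (mem_spans_node.2 (Or.inr (Or.inl h))))
            (hl ▸ (spans_bounds h).2.2)
        · exact mem_spans_left ((hE q hq).2 (mem_spans_node.2 (Or.inr (Or.inl h))))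
            (hl ▸ (spans_bounds h).2.2)
      subst h1
      have h2 : r = r' := by
        refine ihr hr hX.2.2 hY.2.2 fun q hq => ⟨fun h => ?_, fun h => ?_⟩
        · exact mem_spans_right ((hE q hq).1 (mem_spans_node.2 (Or.inr (Or.inr h))))
            (spans_bounds h).1
        · exact mem_spans_right ((hE q hq).2 (mem_spans_node.2 (Or.inr (Or.inr h))))
            (spans_bounds h).1
      subst h2
      rfl

theorem comb_eq_comb {S T : BTree} (hn : S.numNodes = T.numNodes) (hS : E ⊆ spans 0 S)
    (hT : E ⊆ spans 0 T) : comb E 0 S none = comb E 0 T none := by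
  refine eq_of_leftIn E ?_ (leftIn_comb E S 0).1 (leftIn_comb E T 0).1 fun q hq => ?_
  · rw [(numNodes_comb E S 0).1, (numNodes_comb E T 0).1, hn]
  · exact iff_of_true ((spans_comb E S 0).1 q hq (hS hq)) ((spans_comb E T 0).1 q hq (hT hq))

end Comb

/-- Lifting from `S` to the combed form, and back from the combed form to `T`. -/
def rotationPath (S T : BTree) : List Rotation :=
  (lifts (commonSpans S T) 0 S).map (fun q => ⟨.right, q.1⟩) ++
    (lifts (commonSpans S T) 0 T).reverse.map fun q => ⟨.left, q.2⟩

theorem commonSpans_subset_left (S T : BTree) : commonSpans S T ⊆ spans 0 S :=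
  (Finset.erase_subset _ _).trans Finset.inter_subset_left

theorem commonSpans_subset_right (S T : BTree) : commonSpans S T ⊆ spans 0 T :=
  (Finset.erase_subset _ _).trans Finset.inter_subset_right

theorem applyRotations_rotationPath {S T : BTree} (h : S.numNodes = T.numNodes) :
    applyRotations (rotationPath S T) S = some T := by
  rw [rotationPath, applyRotations_append, (lifts_comb _ S 0).1.apply_right,
    comb_eq_comb _ h (commonSpans_subset_left S T) (commonSpans_subset_right S T),
    Option.bind_some, (lifts_comb _ T 0).1.apply_left]

theorem length_lifts_le {E : Finset (ℕ × ℕ)} {t : BTree} (hE : E ⊆ spans 0 t)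
    (h : 1 ≤ t.numNodes) (hr : (1, t.numNodes) ∉ E) :
    (lifts E 0 t).length + E.card + 1 ≤ t.numNodes := by
  have h1 := length_lifts_add_length_chain_le E 0 0 t
  -- The whole tree is treated as the left subtree of a fictitious node `0`. Its root, not in `E`,
  -- would be lifted over that node; this unperformed lift saves one in the count.
  have h2 : 1 ≤ (chain E 0 0 t).length := by
    cases t with
    | nil => simp at h
    | node u l r =>
      rw [chain, if_neg]
      · simp
      · simpa using hr
  have h3 := Finset.card_sdiff_add_card_eq_card hE
  rw [card_spans] at h3
  omega

theorem root_notMem_commonSpans (S T : BTree) : (1, S.numNodes) ∉ commonSpans S T :=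
  Finset.notMem_erase _ _

/-! ### Tables indexed by the nodes of a tree -/

/-- `P off l r` holds for every subtree `.node () l r`, `off + 1` being its first key. -/
def ForNodes (P : ℕ → BTree → BTree → Prop) : ℕ → BTree → Prop
  | _, .nil => True
  | off, .node _ l r => P off l r ∧ ForNodes P off l ∧ ForNodes P (off + l.numNodes + 1) r

theorem ForNodes.mono {P Q : ℕ → BTree → BTree → Prop} {off : ℕ} {t : BTree}
    (hP : ForNodes P off t)
    (h : ∀ o l r, off ≤ o → o + l.numNodes + r.numNodes + 1 ≤ off + t.numNodes →
      P o l r → Q o l r) : ForNodes Q off t := by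
  induction t generalizing off with
  | nil => trivial
  | node u l r ihl ihr =>
    simp only [BinaryTree.numNodes] at h
    exact ⟨h _ _ _ le_rfl (by omega) hP.1,
      ihl hP.2.1 fun o l r h1 h2 => h o l r h1 (by omega),
      ihr hP.2.2 fun o l r h1 h2 => h o l r (by omega) (by omega)⟩

/-- `f` maps the key of each node to the key of its left child. -/
def IsLeft (f : ℕ → ℕ) : ℕ → BTree → Prop :=
  ForNodes fun off l _ => f (off + l.numNodes + 1) = rootKey off l

/-- `f` maps the key of each node to the key of its right child. -/
def IsRight (f : ℕ → ℕ) : ℕ → BTree → Prop :=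
  ForNodes fun off l r => f (off + l.numNodes + 1) = rootKey (off + l.numNodes + 1) r

/-- `f` maps the key of each node to the first key of its subtree. -/
def IsFirst (f : ℕ → ℕ) : ℕ → BTree → Prop :=
  ForNodes fun off l _ => f (off + l.numNodes + 1) = off + 1

/-- `f` maps the key of each node to the last key of its subtree. -/
def IsLast (f : ℕ → ℕ) : ℕ → BTree → Prop :=
  ForNodes fun off l r => f (off + l.numNodes + 1) = off + l.numNodes + r.numNodes + 1

theorem isLeft_leftChild (off : ℕ) (t : BTree) : IsLeft (leftChild off t) off t := by
  induction t generalizing off with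
  | nil => trivial
  | node u l r ihl ihr =>
    refine ⟨by simp [leftChild], (ihl off).mono fun o a b h1 h2 h => ?_,
      (ihr _).mono fun o a b h1 h2 h => ?_⟩
    · rwa [leftChild, if_neg (by omega), if_pos (by omega)]
    · rwa [leftChild, if_neg (by omega), if_neg (by omega)]

theorem isRight_rightChild (off : ℕ) (t : BTree) : IsRight (rightChild off t) off t := by
  induction t generalizing off with
  | nil => trivial
  | node u l r ihl ihr =>
    refine ⟨by simp [rightChild], (ihl off).mono fun o a b h1 h2 h => ?_,
      (ihr _).mono fun o a b h1 h2 h => ?_⟩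
    · rwa [rightChild, if_neg (by omega), if_pos (by omega)]
    · rwa [rightChild, if_neg (by omega), if_neg (by omega)]

theorem IsFirst.congr {f g : ℕ → ℕ} {off : ℕ} {t : BTree} (hf : IsFirst f off t)
    (h : ∀ k, off < k → k ≤ off + t.numNodes → g k = f k) : IsFirst g off t :=
  hf.mono fun o l r h1 h2 h3 => by rw [h _ (by omega) (by omega), h3]

theorem IsLast.congr {f g : ℕ → ℕ} {off : ℕ} {t : BTree} (hf : IsLast f off t)
    (h : ∀ k, off < k → k ≤ off + t.numNodes → g k = f k) : IsLast g off t :=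
  hf.mono fun o l r h1 h2 h3 => by rw [h _ (by omega) (by omega), h3]

theorem IsFirst.lt {f : ℕ → ℕ} {off : ℕ} {t : BTree} (h : IsFirst f off t) {k : ℕ}
    (h1 : off < k) (h2 : k ≤ off + t.numNodes) : off < f k := by
  induction t generalizing off with
  | nil => simp at h2; omega
  | node u l r ihl ihr =>
    simp only [BinaryTree.numNodes] at h2
    rcases lt_trichotomy k (off + l.numNodes + 1) with hk | hk | hk
    · exact ihl h.2.1 h1 (by omega)
    · have := h.1
      rw [hk]; omega
    · have := ihr h.2.2 hk (by omega)
      omega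

theorem IsLast.le {f : ℕ → ℕ} {off : ℕ} {t : BTree} (h : IsLast f off t) {k : ℕ}
    (h1 : off < k) (h2 : k ≤ off + t.numNodes) : f k ≤ off + t.numNodes := by
  induction t generalizing off with
  | nil => simp at h2; omega
  | node u l r ihl ihr =>
    simp only [BinaryTree.numNodes] at h2 ⊢
    rcases lt_trichotomy k (off + l.numNodes + 1) with hk | hk | hk
    · have := ihl h.2.1 h1 (by omega)
      omega
    · have := h.1
      rw [hk]; omega
    · have := ihr h.2.2 hk (by omega)
      omega

/-- An interval is the key interval of a left child iff it starts at the first key below the node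
following it, and that of a right child iff it ends at the last key below the node preceding it. -/
theorem mem_spans_iff_first_or_last {f g : ℕ → ℕ} {off : ℕ} {t : BTree} (hf : IsFirst f off t)
    (hg : IsLast g off t) {a b : ℕ} (ha : off < a) (hab : a ≤ b) (hb : b ≤ off + t.numNodes) :
    ((b < off + t.numNodes ∧ f (b + 1) = a) ∨ (off + 1 < a ∧ g (a - 1) = b)) ↔
      (a, b) ∈ spans off t ∧ ¬ (a = off + 1 ∧ b = off + t.numNodes) := by
  induction t generalizing off with
  | nil => simp at hb; omega
  | node u l r ihl ihr =>
    have hf1 : f (off + l.numNodes + 1) = off + 1 := hf.1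
    have hg1 : g (off + l.numNodes + 1) = off + l.numNodes + r.numNodes + 1 := hg.1
    have il := ihl hf.2.1 hg.2.1
    have ir := ihr hf.2.2 hg.2.2
    have bl : (a, b) ∈ spans off l → off < a ∧ a ≤ b ∧ b ≤ off + l.numNodes := spans_bounds
    have br : (a, b) ∈ spans (off + l.numNodes + 1) r →
      off + l.numNodes + 1 < a ∧ a ≤ b ∧ b ≤ off + l.numNodes + 1 + r.numNodes := spans_bounds
    have rl : 0 < l.numNodes → (off + 1, off + l.numNodes) ∈ spans off l := by
      cases l with
      | nil => simp
      | node v c d =>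
        intro _
        have := root_mem_spans (off := off) (u := v) (l := c) (r := d)
        simpa only [BinaryTree.numNodes, add_assoc] using this
    have rr : 0 < r.numNodes → (off + l.numNodes + 1 + 1, off + l.numNodes + 1 + r.numNodes) ∈
        spans (off + l.numNodes + 1) r := by
      cases r with
      | nil => simp
      | node v c d =>
        intro _
        have := root_mem_spans (off := off + l.numNodes + 1) (u := v) (l := c) (r := d)
        simpa only [BinaryTree.numNodes, add_assoc] using this
    rw [mem_spans_node, Prod.mk.injEq]
    simp only [BinaryTree.numNodes] at hb ⊢
    -- The interval lies to the right of the root key, to its left, or contains it. In the first two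
    -- cases the induction hypothesis decides, except when the interval is adjacent to the root key.
    rcases lt_or_ge (off + l.numNodes + 1) a with h1 | h1
    · have ir := ir h1 (by omega)
      rcases Nat.lt_or_ge (off + l.numNodes + 1 + 1) a with h2 | h2
      · constructor
        · intro h
          have := ir.1 (h.imp (fun h => ⟨by omega, h.2⟩) (fun h => ⟨h2, h.2⟩))
          exact ⟨Or.inr (Or.inr this.1), by omega⟩
        · rintro ⟨h | h | h, h'⟩
          · omega
          · have := bl h; omega
          · exact (ir.2 ⟨h, by omega⟩).imp (fun h => ⟨by omega, h.2⟩) (fun h => ⟨by omega, h.2⟩)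
      -- Here `a - 1` is the root, whose last key is the last key of the tree, so the second test
      -- recognizes exactly the right child of the root.
      · have h2 : a = off + l.numNodes + 1 + 1 := by omega
        subst h2
        rw [Nat.add_sub_cancel, hg1]
        constructor
        · rintro (h | h)
          · exact ⟨Or.inr (Or.inr (ir.1 (Or.inl ⟨by omega, h.2⟩)).1), by omega⟩
          · rw [← h.2]
            refine ⟨Or.inr (Or.inr ?_), by omega⟩
            have := rr (by omega)
            rwa [show off + l.numNodes + r.numNodes + 1 = off + l.numNodes + 1 + r.numNodes by
              omega]
        · rintro ⟨h | h | h, h'⟩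
          · omega
          · have := bl h; omega
          · rcases eq_or_ne b (off + l.numNodes + 1 + r.numNodes) with hb' | hb'
            · right; omega
            · rcases ir.2 ⟨h, by omega⟩ with h3 | h3
              · left; exact ⟨by omega, h3.2⟩
              · omega
    · rcases Nat.lt_or_ge b (off + l.numNodes + 1) with h2 | h2
      · have il := il ha (by omega)
        rcases Nat.lt_or_ge b (off + l.numNodes) with h3 | h3
        · constructor
          · intro h
            have := il.1 (h.imp (fun h => ⟨by omega, h.2⟩) (fun h => h))
            exact ⟨Or.inr (Or.inl this.1), by omega⟩
          · rintro ⟨h | h | h, h'⟩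
            · omega
            · exact (il.2 ⟨h, by omega⟩).imp (fun h => ⟨by omega, h.2⟩) (fun h => h)
            · have := br h; omega
        -- Mirror case: `b + 1` is the root, and the first test recognizes its left child.
        · have h3 : b = off + l.numNodes := by omega
          subst h3
          rw [hf1]
          constructor
          · rintro (h | h)
            · rw [← h.2]
              exact ⟨Or.inr (Or.inl (rl (by omega))), by omega⟩
            · exact ⟨Or.inr (Or.inl (il.1 (Or.inr h)).1), by omega⟩
          · rintro ⟨h | h | h, h'⟩
            · omega
            · rcases eq_or_ne a (off + 1) with hb' | hb'
              · left; omega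
              · rcases il.2 ⟨h, by omega⟩ with h3 | h3
                · omega
                · right; exact h3
            · have := br h; omega
      -- An interval containing the root key can only be that of the root. Both tests fail: the
      -- first key of `b + 1` lies right of the root key, the last key of `a - 1` left of it.
      · constructor
        · rintro (h | h)
          · have := IsFirst.lt hf.2.2 (k := b + 1) (by omega) (by omega)
            omega
          · have := IsLast.le hg.2.1 (k := a - 1) (by omega) (by omega)
            omega
        · rintro ⟨h | h | h, h'⟩
          · omega
          · have := bl h; omega
          · have := br h; omega

/-- The test by which the program recognizes the lower ends of the common edges: `lo` and `hi` are
the tables of first and last keys of one tree, `lo'` and `hi'` those of the other. -/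
def CommonAt (lo hi lo' hi' : ℕ → ℕ) (k : ℕ) : Prop :=
  lo' (hi k + 1) = lo k ∨ hi' (lo k - 1) = hi k

/-- The zeros at `n + 1` and at `0` act as sentinels: they never equal a positive key, so the test
needs no range check and automatically rejects the root. -/
theorem commonAt_iff {lo hi lo' hi' : ℕ → ℕ} {T : BTree} (hf : IsFirst lo' 0 T)
    (hg : IsLast hi' 0 T) (h1 : lo' (T.numNodes + 1) = 0) (h2 : hi' 0 = 0) {k : ℕ}
    (ha : 0 < lo k) (hab : lo k ≤ hi k) (hb : hi k ≤ T.numNodes) :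
    CommonAt lo hi lo' hi' k ↔ (lo k, hi k) ∈ (spans 0 T).erase (1, T.numNodes) := by
  have := mem_spans_iff_first_or_last hf hg ha hab (by omega)
  rw [Finset.mem_erase, and_comm, ne_eq, Prod.mk.injEq]
  simp only [zero_add] at this
  rw [← this, CommonAt]
  constructor
  · rintro (h | h)
    · left
      refine ⟨lt_of_le_of_ne hb fun h' => ?_, h⟩
      rw [h', h1] at h; omega
    · right
      refine ⟨lt_of_le_of_ne ha fun h' => ?_, h⟩
      rw [← h', h2] at h; omega
  · exact Or.imp (fun h => h.2) fun h => h.2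

/-- `CommonAt` decides membership in `E` for the nodes of a tree. -/
def Detects (E : Finset (ℕ × ℕ)) (lo hi lo' hi' : ℕ → ℕ) : ℕ → BTree → Prop :=
  ForNodes fun off l r => CommonAt lo hi lo' hi' (off + l.numNodes + 1) ↔
    (off + 1, off + l.numNodes + r.numNodes + 1) ∈ E

/-- This supplies the half of membership in the intersection that the test does not check: the
interval of a visited node belongs to its own tree. -/
theorem ForNodes.mem {P : ℕ → BTree → BTree → Prop} {off : ℕ} {t : BTree} (h : ForNodes P off t) :
    ForNodes (fun o l r => P o l r ∧ (o + 1, o + l.numNodes + r.numNodes + 1) ∈ spans off t)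
      off t := by
  induction t generalizing off with
  | nil => trivial
  | node u l r ihl ihr =>
    exact ⟨⟨h.1, root_mem_spans⟩,
      (ihl h.2.1).mono fun o a b _ _ h => ⟨h.1, mem_spans_node.2 (Or.inr (Or.inl h.2))⟩,
      (ihr h.2.2).mono fun o a b _ _ h => ⟨h.1, mem_spans_node.2 (Or.inr (Or.inr h.2))⟩⟩

theorem ForNodes.and {P Q : ℕ → BTree → BTree → Prop} {off : ℕ} {t : BTree}
    (h : ForNodes P off t) (h' : ForNodes Q off t) :
    ForNodes (fun o l r => P o l r ∧ Q o l r) off t := by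
  induction t generalizing off with
  | nil => trivial
  | node u l r ihl ihr => exact ⟨⟨h.1, h'.1⟩, ihl h.2.1 h'.2.1, ihr h.2.2 h'.2.2⟩

theorem detects {lo hi lo' hi' : ℕ → ℕ} {S T : BTree} {E : Finset (ℕ × ℕ)}
    (hS : IsFirst lo 0 S) (hS' : IsLast hi 0 S)
    (hf : IsFirst lo' 0 T) (hg : IsLast hi' 0 T) (h1 : lo' (T.numNodes + 1) = 0) (h2 : hi' 0 = 0)
    (hn : S.numNodes = T.numNodes)
    (hE : E = (spans 0 S ∩ spans 0 T).erase (1, T.numNodes)) : Detects E lo hi lo' hi' 0 S := by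
  refine (ForNodes.and hS hS').mem.mono fun o l r h3 h4 h => ?_
  obtain ⟨⟨h5, h6⟩, h7⟩ := h
  rw [commonAt_iff hf hg h1 h2 (by omega) (by omega) (by omega), h5, h6, hE]
  simp only [Finset.mem_erase, Finset.mem_inter]
  tauto

/-! ### Executions -/

/-- Some iterations of a loop. -/
inductive Iters (B : ℕ) (e : Expr) (c : Cmd) : Store → ℕ → Store → Prop where
  | refl (s : Store) : Iters B e c s 0 s
  | step {s s₁ s₂ : Store} {t u : ℕ} (h : e.eval s ≠ 0) (hc : Exec B c s t s₁)
      (hs : Iters B e c s₁ u s₂) : Iters B e c s (e.cost + 1 + t + u) s₂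

namespace Iters

variable {B : ℕ} {e : Expr} {c : Cmd} {s s₁ s₂ : Store} {t u : ℕ}

theorem trans (h : Iters B e c s t s₁) (h' : Iters B e c s₁ u s₂) :
    Iters B e c s (t + u) s₂ := by
  induction h with
  | refl s => rwa [zero_add]
  | step h hc _ ih =>
    rw [add_assoc]
    exact step h hc (ih h')

theorem exec (h : Iters B e c s t s₁) (he : e.eval s₁ = 0) :
    Exec B (.while e c) s (t + (e.cost + 1)) s₁ := by
  induction h with
  | refl s => rw [zero_add]; exact .while_false he
  | step h hc _ ih =>
    rw [add_assoc]
    exact .while_true h hc (ih he)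

end Iters

/-- `s'` agrees with `s` except on the scalar variables in `V` and the arrays in `A`. -/
def Frame (V A : List ℕ) (s s' : Store) : Prop :=
  (∀ x, x ∉ V → s'.var x = s.var x) ∧ ∀ a, a ∉ A → s'.arr a = s.arr a

theorem Frame.refl (V A : List ℕ) (s : Store) : Frame V A s s := ⟨fun _ _ => rfl, fun _ _ => rfl⟩

theorem Frame.trans {V A : List ℕ} {s s₁ s₂ : Store} (h : Frame V A s s₁) (h' : Frame V A s₁ s₂) :
    Frame V A s s₂ :=
  ⟨fun x hx => (h'.1 x hx).trans (h.1 x hx), fun a ha => (h'.2 a ha).trans (h.2 a ha)⟩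

theorem Frame.mono {V V' A A' : List ℕ} {s s' : Store} (h : Frame V A s s') (hV : V ⊆ V')
    (hA : A ⊆ A') : Frame V' A' s s' :=
  ⟨fun x hx => h.1 x fun h => hx (hV h), fun a ha => h.2 a fun h => ha (hA h)⟩

theorem Frame.setVar {V A : List ℕ} {s s' : Store} (h : Frame V A s s') {x : ℕ} (hx : x ∈ V)
    (v : ℕ) : Frame V A s (s'.setVar x v) :=
  ⟨fun y hy => by
    rw [← h.1 y hy]
    exact Function.update_of_ne (ne_of_mem_of_not_mem hx hy).symm _ _, h.2⟩

theorem Frame.setArr {V A : List ℕ} {s s' : Store} (h : Frame V A s s') {a : ℕ} (ha : a ∈ A)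
    (i v : ℕ) : Frame V A s (s'.setArr a i v) :=
  ⟨h.1, fun y hy => by
    rw [← h.2 y hy]
    exact Function.update_of_ne (ne_of_mem_of_not_mem ha hy).symm _ _⟩

section simpLemmas

variable (s : Store)

@[simp] theorem Store.var_setVar (x v y : ℕ) :
    (s.setVar x v).var y = if y = x then v else s.var y := Function.update_apply _ _ _ _

@[simp] theorem Store.arr_setVar (x v : ℕ) : (s.setVar x v).arr = s.arr := rfl

@[simp] theorem Store.var_setArr (a i v : ℕ) : (s.setArr a i v).var = s.var := rfl

@[simp] theorem Store.arr_setArr (a i v b j : ℕ) :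
    (s.setArr a i v).arr b j = if b = a ∧ j = i then v else s.arr b j := by
  by_cases h : b = a
  · subst h
    simp [Store.setArr, Function.update_apply]
  · simp [Store.setArr, h]

end simpLemmas

theorem Exec.set_eq {B x v : ℕ} {e : Expr} {s : Store} (he : e.eval s = v) (hB : v ≤ B) :
    Exec B (.set x e) s (e.cost + 1) (s.setVar x v) := by
  subst he
  exact .set s x e hB

theorem Exec.put_eq {B a j v : ℕ} {i e : Expr} {s : Store} (hi : i.eval s = j)
    (he : e.eval s = v) (hj : j ≤ B) (hB : v ≤ B) :
    Exec B (.put a i e) s (i.cost + e.cost + 1) (s.setArr a j v) := by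
  subst hi he
  exact .put s a i e hj hB

/-! ### Computing the first and the last keys -/

/-- Store at `lo` the table of first keys of the tree whose left children are in the array `L`. -/
def firstBody (L lo : ℕ) : Cmd :=
  .seq (.set 5 (.add (.var 5) (.const 1)))
    (.ite (.eq (.get L (.var 5)) (.const 0)) (.put lo (.var 5) (.var 5))
      (.put lo (.var 5) (.get lo (.get L (.var 5)))))

def firstLoop (L lo : ℕ) : Cmd :=
  .seq (.set 5 (.const 0)) (.while (.lt (.var 5) (.var 0)) (firstBody L lo))

theorem IsFirst.rootKey_eq_zero_or {f : ℕ → ℕ} {off : ℕ} {t : BTree} (h : IsFirst f off t) :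
    (rootKey off t = 0 ∧ t.numNodes = 0) ∨ (rootKey off t ≠ 0 ∧ f (rootKey off t) = off + 1) := by
  cases t with
  | nil => simp [rootKey]
  | node u l r => exact Or.inr ⟨by simp [rootKey], h.1⟩

theorem IsLast.rootKey_eq_zero_or {f : ℕ → ℕ} {off : ℕ} {t : BTree} (h : IsLast f off t) :
    (rootKey off t = 0 ∧ t.numNodes = 0) ∨
      (rootKey off t ≠ 0 ∧ f (rootKey off t) = off + t.numNodes) := by
  cases t with
  | nil => simp [rootKey]
  | node u l r => exact Or.inr ⟨by simp [rootKey], h.1.trans (by simp [add_assoc])⟩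

/-- Increasing key order is in-order traversal, so the iterations for a subtree are those for its
left subtree, one for the root, and those for its right subtree. At the root, the entry of the left
child is already known. One iteration costs at most 16 steps plus 4 for the loop test. -/
theorem iters_firstBody {B L lo : ℕ} (hL : L ≠ lo) (t : BTree) (off : ℕ) (s : Store)
    (h5 : s.var 5 = off) (h0 : off + t.numNodes ≤ s.var 0) (hB : s.var 0 ≤ B)
    (ht : IsLeft (s.arr L) off t) :
    ∃ u s', Iters B (.lt (.var 5) (.var 0)) (firstBody L lo) s u s' ∧ u ≤ 20 * t.numNodes ∧
      s'.var 5 = off + t.numNodes ∧ Frame [5] [lo] s s' ∧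
      (∀ k, (k ≤ off ∨ off + t.numNodes < k) → s'.arr lo k = s.arr lo k) ∧
      IsFirst (s'.arr lo) off t := by
  induction t generalizing off s with
  | nil => exact ⟨0, s, .refl s, by simp, by simpa using h5, .refl _ _ _, fun _ _ => rfl, trivial⟩
  | node v l r ihl ihr =>
    simp only [BinaryTree.numNodes] at h0
    obtain ⟨u₁, s₁, e₁, c₁, p₁, f₁, o₁, i₁⟩ := ihl off s h5 (by omega) hB ht.2.1
    have a₁ : s₁.arr L = s.arr L := f₁.2 L (by simpa using hL)
    have v₁ : s₁.var 0 = s.var 0 := f₁.1 0 (by simp)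
    set k := off + l.numNodes + 1 with hk
    have hLk : s₁.arr L k = rootKey off l := by rw [a₁]; exact ht.1
    obtain ⟨u₂, e₂, c₂⟩ : ∃ u₂, Exec B (firstBody L lo) s₁ u₂
        ((s₁.setVar 5 k).setArr lo k (off + 1)) ∧ u₂ ≤ 16 := by
      have hset : Exec B (.set 5 (.add (.var 5) (.const 1))) s₁
          (Expr.cost (.add (.var 5) (.const 1)) + 1) (s₁.setVar 5 k) :=
        .set_eq (by simp only [Expr.eval, p₁]; omega) (by omega)
      rcases i₁.rootKey_eq_zero_or with ⟨hr, hl⟩ | ⟨hr, hl⟩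
      · refine ⟨_, .seq hset (.ite_true (by simp [Expr.eval, hLk, hr])
          (.put_eq (by simp [Expr.eval]) ?_ (by omega) (by omega))), by simp [Expr.cost]⟩
        simp [Expr.eval]; omega
      · refine ⟨_, .seq hset (.ite_false (by simp [Expr.eval, hLk, hr])
          (.put_eq (by simp [Expr.eval]) ?_ (by omega) (by omega))), by simp [Expr.cost]⟩
        simp [Expr.eval, hLk, hl]
    set s₂ := (s₁.setVar 5 k).setArr lo k (off + 1) with hs₂
    have f₂ : Frame [5] [lo] s₁ s₂ :=
      ((Frame.refl _ _ s₁).setVar (by simp) _).setArr (by simp) _ _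
    have a₂ : s₂.arr L = s.arr L := (f₂.2 L (by simpa using hL)).trans a₁
    have v₂ : s₂.var 0 = s.var 0 := (f₂.1 0 (by simp)).trans v₁
    obtain ⟨u₃, s₃, e₃, c₃, p₃, f₃, o₃, i₃⟩ := ihr k s₂ (by simp [hs₂]) (by omega)
      (by omega) (by rw [a₂]; exact ht.2.2)
    refine ⟨_, s₃, e₁.trans (.step ?_ e₂ e₃), ?_, ?_, (f₁.trans f₂).trans f₃, ?_, ?_, ?_, i₃⟩
    · simp [Expr.eval, p₁, v₁]
      omega
    · simp only [BinaryTree.numNodes, Expr.cost]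
      omega
    · simp only [BinaryTree.numNodes]
      omega
    · intro j hj
      simp only [BinaryTree.numNodes] at hj
      rw [o₃ j (by omega), hs₂, Store.arr_setArr, if_neg (by omega), Store.arr_setVar,
        o₁ j (by omega)]
    · show s₃.arr lo k = off + 1
      rw [o₃ k (by omega)]
      simp [hs₂]
    · refine i₁.congr fun j hj hj' => ?_
      rw [o₃ j (by omega), hs₂, Store.arr_setArr, if_neg (by omega), Store.arr_setVar]

theorem exec_firstLoop {B L lo : ℕ} (hL : L ≠ lo) {t : BTree} {s : Store}
    (h0 : s.var 0 = t.numNodes) (hB : s.var 0 ≤ B) (ht : IsLeft (s.arr L) 0 t) :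
    ∃ u s', Exec B (firstLoop L lo) s u s' ∧ u ≤ 20 * t.numNodes + 10 ∧ Frame [5] [lo] s s' ∧
      (∀ k, (k = 0 ∨ t.numNodes < k) → s'.arr lo k = s.arr lo k) ∧ IsFirst (s'.arr lo) 0 t := by
  obtain ⟨u, s', e, c, p, f, o, i⟩ := iters_firstBody (B := B) hL t 0 (s.setVar 5 0) (by simp)
    (by simp [h0]) (by simpa using hB) (by simpa using ht)
  have f' : Frame [5] [lo] s (s.setVar 5 0) := (Frame.refl _ _ s).setVar (by simp) _
  refine ⟨_, s', .seq (.set s 5 (.const 0) (by simp [Expr.eval])) (e.exec ?_), ?_, f'.trans f,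
    fun k hk => ?_, i⟩
  · have := f.1 0 (by simp)
    simp only [Store.var_setVar] at this
    simp [Expr.eval, p, this, h0]
  · simp only [Expr.cost]; omega
  · rw [o k (by omega)]; rfl

/-- Store at `hi` the table of last keys of the tree whose right children are in the array `R`. -/
def lastBody (R hi : ℕ) : Cmd :=
  .seq (.ite (.eq (.get R (.var 5)) (.const 0)) (.put hi (.var 5) (.var 5))
      (.put hi (.var 5) (.get hi (.get R (.var 5)))))
    (.set 5 (.sub (.var 5) (.const 1)))

def lastLoop (R hi : ℕ) : Cmd :=
  .seq (.set 5 (.var 0)) (.while (.var 5) (lastBody R hi))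

/-- The mirror image: decreasing order makes the entry of the right child available at each node. -/
theorem iters_lastBody {B R hi : ℕ} (hR : R ≠ hi) (t : BTree) (off : ℕ) (s : Store)
    (h5 : s.var 5 = off + t.numNodes) (hB : off + t.numNodes ≤ B)
    (ht : IsRight (s.arr R) off t) :
    ∃ u s', Iters B (.var 5) (lastBody R hi) s u s' ∧ u ≤ 20 * t.numNodes ∧
      s'.var 5 = off ∧ Frame [5] [hi] s s' ∧
      (∀ k, (k ≤ off ∨ off + t.numNodes < k) → s'.arr hi k = s.arr hi k) ∧
      IsLast (s'.arr hi) off t := by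
  induction t generalizing off s with
  | nil => exact ⟨0, s, .refl s, by simp, by simpa using h5, .refl _ _ _, fun _ _ => rfl, trivial⟩
  | node v l r ihl ihr =>
    simp only [BinaryTree.numNodes] at h5 hB
    set k := off + l.numNodes + 1 with hk
    obtain ⟨u₁, s₁, e₁, c₁, p₁, f₁, o₁, i₁⟩ := ihr k s (by omega) (by omega) ht.2.2
    have a₁ : s₁.arr R = s.arr R := f₁.2 R (by simpa using hR)
    have hRk : s₁.arr R k = rootKey k r := by rw [a₁]; exact ht.1
    obtain ⟨u₂, e₂, c₂⟩ : ∃ u₂, Exec B (lastBody R hi) s₁ u₂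
        ((s₁.setArr hi k (k + r.numNodes)).setVar 5 (k - 1)) ∧ u₂ ≤ 16 := by
      have hset : Exec B (.set 5 (.sub (.var 5) (.const 1))) (s₁.setArr hi k (k + r.numNodes))
          (Expr.cost (.sub (.var 5) (.const 1)) + 1)
          ((s₁.setArr hi k (k + r.numNodes)).setVar 5 (k - 1)) :=
        .set_eq (by simp [Expr.eval, p₁]) (by omega)
      rcases i₁.rootKey_eq_zero_or with ⟨hr, hl⟩ | ⟨hr, hl⟩
      · exact ⟨_, .seq (.ite_true (by simp [Expr.eval, hRk, hr, p₁])
          (.put_eq (by simp [Expr.eval, p₁]) (by simp [Expr.eval, hl, p₁]) (by omega)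
            (by omega))) hset, by simp [Expr.cost]⟩
      · exact ⟨_, .seq (.ite_false (by simp [Expr.eval, hRk, hr, p₁])
          (.put_eq (by simp [Expr.eval, p₁]) (by simp [Expr.eval, hRk, hl, p₁]) (by omega)
            (by omega))) hset, by simp [Expr.cost]⟩
    set s₂ := (s₁.setArr hi k (k + r.numNodes)).setVar 5 (k - 1) with hs₂
    have f₂ : Frame [5] [hi] s₁ s₂ :=
      ((Frame.refl _ _ s₁).setArr (by simp) _ _).setVar (by simp) _
    have a₂ : s₂.arr R = s.arr R := (f₂.2 R (by simpa using hR)).trans a₁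
    obtain ⟨u₃, s₃, e₃, c₃, p₃, f₃, o₃, i₃⟩ := ihl off s₂ (by simp [hs₂]; omega)
      (by omega) (by rw [a₂]; exact ht.2.1)
    refine ⟨_, s₃, e₁.trans (.step ?_ e₂ e₃), ?_, p₃, (f₁.trans f₂).trans f₃, ?_, ?_, i₃, ?_⟩
    · simp only [Expr.eval]
      omega
    · simp only [BinaryTree.numNodes, Expr.cost]
      omega
    · intro j hj
      simp only [BinaryTree.numNodes] at hj
      rw [o₃ j (by omega), hs₂, Store.arr_setVar, Store.arr_setArr, if_neg (by omega),
        o₁ j (by omega)]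
    · show s₃.arr hi k = off + l.numNodes + r.numNodes + 1
      rw [o₃ k (by omega)]
      simp [hs₂]; omega
    · refine i₁.congr fun j hj hj' => ?_
      rw [o₃ j (by omega), hs₂, Store.arr_setVar, Store.arr_setArr, if_neg (by omega)]

theorem exec_lastLoop {B R hi : ℕ} (hR : R ≠ hi) {t : BTree} {s : Store}
    (h0 : s.var 0 = t.numNodes) (hB : s.var 0 ≤ B) (ht : IsRight (s.arr R) 0 t) :
    ∃ u s', Exec B (lastLoop R hi) s u s' ∧ u ≤ 20 * t.numNodes + 10 ∧ Frame [5] [hi] s s' ∧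
      (∀ k, (k = 0 ∨ t.numNodes < k) → s'.arr hi k = s.arr hi k) ∧ IsLast (s'.arr hi) 0 t := by
  obtain ⟨u, s', e, c, p, f, o, i⟩ := iters_lastBody (B := B) hR t 0 (s.setVar 5 (s.var 0))
    (by simp [h0]) (by omega) (by simpa using ht)
  have f' : Frame [5] [hi] s (s.setVar 5 (s.var 0)) := (Frame.refl _ _ s).setVar (by simp) _
  refine ⟨_, s', .seq (.set s 5 (.var 0) hB) (e.exec p), ?_, f'.trans f,
    fun k hk => ?_, i⟩
  · simp only [Expr.cost]; omega
  · rw [o k (by omega)]; rfl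

/-! ### Emitting the lifts -/

/-- The registers used for emitting the lifts of a tree: the arrays `L`, `R` of its children, its
tables `lo`, `hi` of first and last keys, the tables `lo'`, `hi'` of the other tree, the output
arrays `P` and `X`, the variable `c` for the length of the output, and the variable `v` to be
decreased by the number of common edges. -/
structure EmitRegs where
  (L R lo hi lo' hi' P X c v : ℕ)
  P_ne_X : P ≠ X
  arrays_notMem : ∀ a ∈ [L, R, lo, hi, lo', hi'], a ∉ [P, X]
  c_notMem : c ∉ [0, 5, 6, v]
  v_notMem : v ∉ [0, 5, 6]

theorem Expr.eval_eq_eq_zero_iff (e f : Expr) (s : Store) :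
    (Expr.eq e f).eval s = 0 ↔ e.eval s ≠ f.eval s := by
  rw [Expr.eval]
  split_ifs with h <;> simp [h]

namespace EmitRegs

variable (ρ : EmitRegs)

/-- The program text of `CommonAt`. -/
def testExpr (x : ℕ) : Expr :=
  .add (.eq (.get ρ.lo' (.add (.get ρ.hi (.var x)) (.const 1))) (.get ρ.lo (.var x)))
    (.eq (.get ρ.hi' (.sub (.get ρ.lo (.var x)) (.const 1))) (.get ρ.hi (.var x)))

/-- `CommonAt` for the tables in a store. -/
def Test (s : Store) (k : ℕ) : Prop :=
  CommonAt (s.arr ρ.lo) (s.arr ρ.hi) (s.arr ρ.lo') (s.arr ρ.hi') k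

theorem eval_testExpr (x : ℕ) (s : Store) :
    (ρ.testExpr x).eval s = 0 ↔ ¬ ρ.Test s (s.var x) := by
  rw [testExpr, Expr.eval, Nat.add_eq_zero_iff, Expr.eval_eq_eq_zero_iff,
    Expr.eval_eq_eq_zero_iff, Test, CommonAt, not_or]
  rfl

/-- A conjunction of negations, coded as the vanishing of a sum. The test is evaluated even at the
leaf marker `0`; this is harmless because reads are total. -/
def chainCond : Expr := .eq (.add (.eq (.var 6) (.const 0)) (ρ.testExpr 6)) (.const 0)

theorem eval_chainCond (s : Store) :
    ρ.chainCond.eval s ≠ 0 ↔ s.var 6 ≠ 0 ∧ ¬ ρ.Test s (s.var 6) := by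
  rw [← eval_testExpr, chainCond, ne_eq, Expr.eval_eq_eq_zero_iff, ne_eq, not_not, Expr.eval,
    Expr.eval, Nat.add_eq_zero_iff, Expr.eval_eq_eq_zero_iff]
  rfl

def chainBody : Cmd :=
  .seq (.put ρ.P (.var ρ.c) (.var 5)) (.seq (.put ρ.X (.var ρ.c) (.var 6))
    (.seq (.set ρ.c (.add (.var ρ.c) (.const 1))) (.set 6 (.get ρ.R (.var 6)))))

def body : Cmd :=
  .seq (.ite (ρ.testExpr 5) (.set ρ.v (.sub (.var ρ.v) (.const 1))) .skip)
    (.seq (.set 6 (.get ρ.L (.var 5)))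
      (.seq (.while ρ.chainCond ρ.chainBody) (.set 5 (.sub (.var 5) (.const 1)))))

def loop : Cmd := .seq (.set 5 (.var 0)) (.while (.var 5) ρ.body)

/-- The output so far. -/
def emitted (s : Store) : List (ℕ × ℕ) :=
  (List.range (s.var ρ.c)).map fun j => (s.arr ρ.P j, s.arr ρ.X j)

theorem length_emitted (s : Store) : (ρ.emitted s).length = s.var ρ.c := by simp [emitted]

theorem emitted_congr {s s' : Store} (hc : s'.var ρ.c = s.var ρ.c)
    (hP : s'.arr ρ.P = s.arr ρ.P) (hX : s'.arr ρ.X = s.arr ρ.X) : ρ.emitted s' = ρ.emitted s := by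
  rw [emitted, hc, hP, hX, emitted]

/-- What the loops leave unchanged. -/
def Keeps (s s' : Store) : Prop := Frame [5, 6, ρ.c, ρ.v] [ρ.P, ρ.X] s s'

variable {ρ}

theorem Keeps.arr_eq {s s' : Store} (h : ρ.Keeps s s') {a : ℕ}
    (ha : a ∈ [ρ.L, ρ.R, ρ.lo, ρ.hi, ρ.lo', ρ.hi']) : s'.arr a = s.arr a :=
  h.2 a (ρ.arrays_notMem a ha)

variable (ρ)

/-- `Test` decides membership in `E` for the nodes of a tree. -/
def Detects (E : Finset (ℕ × ℕ)) (s : Store) : ℕ → BTree → Prop :=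
  RotDist.Detects E (s.arr ρ.lo) (s.arr ρ.hi) (s.arr ρ.lo') (s.arr ρ.hi')

variable {ρ}

theorem Keeps.detects {s s' : Store} (h : ρ.Keeps s s') {E : Finset (ℕ × ℕ)} {off : ℕ} {t : BTree}
    (hd : ρ.Detects E s off t) : ρ.Detects E s' off t := by
  rwa [Detects, h.arr_eq (by simp), h.arr_eq (by simp), h.arr_eq (by simp), h.arr_eq (by simp)]

/-- The cost is charged to the emitted lifts. Summed over all nodes `p` it is therefore linear,
however long a single chain may be. -/
theorem exec_chainLoop {B p : ℕ} {E : Finset (ℕ × ℕ)} (t : BTree) (off : ℕ) (s : Store)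
    (h6 : s.var 6 = rootKey off t) (h5 : s.var 5 = p) (hR : IsRight (s.arr ρ.R) off t)
    (hd : ρ.Detects E s off t) (hp : p ≤ B) (ht : off + t.numNodes ≤ B)
    (hc : s.var ρ.c + (chain E p off t).length ≤ B) :
    ∃ u s', Exec B (.while ρ.chainCond ρ.chainBody) s u s' ∧
      u ≤ 45 * (chain E p off t).length + 25 ∧
      ρ.emitted s' = ρ.emitted s ++ chain E p off t ∧ Frame [6, ρ.c] [ρ.P, ρ.X] s s' := by
  induction t generalizing off s with
  | nil =>
    refine ⟨_, s, .while_false (not_ne_iff.1 fun h => ?_), ?_, by simp [chain], .refl _ _ _⟩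
    · exact ((ρ.eval_chainCond s).1 h).1 h6
    · simp [chainCond, testExpr, Expr.cost]
  | node w l r ihl ihr =>
    set k := off + l.numNodes + 1 with hk
    have h6' : s.var 6 = k := h6
    have hd1 : ρ.Test s k ↔ (off + 1, off + l.numNodes + r.numNodes + 1) ∈ E := hd.1
    by_cases hE : (off + 1, off + l.numNodes + r.numNodes + 1) ∈ E
    · refine ⟨_, s, .while_false (not_ne_iff.1 fun h => ?_), ?_, by simp [chain, hE], .refl _ _ _⟩
      · exact ((ρ.eval_chainCond s).1 h).2 (by rw [h6']; exact hd1.2 hE)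
      · simp [chainCond, testExpr, Expr.cost]
    have hch : chain E p off (.node w l r) = (p, k) :: chain E p k r := by
      rw [chain, if_neg hE]
    rw [hch, List.length_cons] at hc ⊢
    simp only [BinaryTree.numNodes] at ht
    have hcn := ρ.c_notMem
    simp only [List.mem_cons, List.not_mem_nil, or_false, not_or] at hcn
    obtain ⟨hc0, hc5, hc6, hcv⟩ := hcn
    have hRn := ρ.arrays_notMem ρ.R (by simp)
    simp only [List.mem_cons, List.not_mem_nil, or_false, not_or] at hRn
    have hRk : s.arr ρ.R k = rootKey k r := hR.1
    have hroot : rootKey k r ≤ k + r.numNodes := by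
      cases r with
      | nil => simp [rootKey]
      | node _ a b => simp only [rootKey, BinaryTree.numNodes]; omega
    set i := s.var ρ.c with hi
    set s₁ := (((s.setArr ρ.P i p).setArr ρ.X i k).setVar ρ.c (i + 1)).setVar 6 (rootKey k r)
      with hs₁
    have e₁ : ∃ u₁, Exec B ρ.chainBody s u₁ s₁ ∧ u₁ ≤ 20 := by
      refine ⟨_, .seq (.put_eq (j := i) rfl h5 (by omega) hp) (.seq
        (.put_eq (j := i) (v := k) rfl h6' (by omega) (by omega))
        (.seq (.set_eq (v := i + 1) rfl (by omega)) (.set_eq ?_ (by omega)))), ?_⟩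
      · simp [Expr.eval, Ne.symm hc6, h6', hRk, hRn]
      · simp [Expr.cost]
    obtain ⟨u₁, e₁, c₁⟩ := e₁
    have f₁ : Frame [6, ρ.c] [ρ.P, ρ.X] s s₁ :=
      ((((Frame.refl _ _ s).setArr (by simp) _ _).setArr (by simp) _ _).setVar (by simp) _).setVar
        (by simp) _
    have k₁ : ρ.Keeps s s₁ := f₁.mono (by simp) (by simp)
    have v₁ : s₁.var ρ.c = i + 1 := by simp [hs₁, hc6]
    have m₁ : ρ.emitted s₁ = ρ.emitted s ++ [(p, k)] := by
      rw [emitted, v₁, List.range_succ, List.map_append, emitted, ← hi]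
      congr 1
      · refine List.map_congr_left fun j hj => ?_
        have hj' : j ≠ i := (List.mem_range.1 hj).ne
        simp [hs₁, hj']
      · simp [hs₁, ρ.P_ne_X]
    obtain ⟨u₂, s₂, e₂, c₂, m₂, f₂⟩ := ihr k s₁ (by simp [hs₁])
      ((f₁.1 5 (by simp [Ne.symm hc5])).trans h5)
      (by rw [k₁.arr_eq (by simp)]; exact hR.2.2) (k₁.detects hd).2.2 (by omega) (by omega)
    refine ⟨_, s₂, .while_true ?_ e₁ e₂, ?_, ?_, f₁.trans f₂⟩
    · rw [eval_chainCond, h6', hd1]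
      exact ⟨by omega, hE⟩
    · have : ρ.chainCond.cost = 23 := by simp [chainCond, testExpr, Expr.cost]
      omega
    · rw [m₂, m₁, List.append_assoc]; rfl

/-- Decreasing key order reproduces the order of `lifts`: right subtree, chain of the node, left
subtree. Truncated subtractions compose additively, so no lower bound on the counter `v` is needed.
-/
theorem iters_body {B : ℕ} {E : Finset (ℕ × ℕ)} (t : BTree) (off : ℕ) (s : Store)
    (h5 : s.var 5 = off + t.numNodes) (hL : IsLeft (s.arr ρ.L) off t)
    (hR : IsRight (s.arr ρ.R) off t)
    (hd : ρ.Detects E s off t) (ht : off + t.numNodes ≤ B) (hv : s.var ρ.v ≤ B)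
    (hc : s.var ρ.c + (lifts E off t).length ≤ B) :
    ∃ u s', Iters B (.var 5) ρ.body s u s' ∧
      u ≤ 70 * t.numNodes + 45 * (lifts E off t).length ∧ s'.var 5 = off ∧
      ρ.emitted s' = ρ.emitted s ++ lifts E off t ∧
      s'.var ρ.v = s.var ρ.v - (spans off t ∩ E).card ∧ ρ.Keeps s s' := by
  induction t generalizing off s with
  | nil =>
    exact ⟨0, s, .refl s, by simp, by simpa using h5, by simp [lifts], by simp [spans],
      .refl _ _ _⟩
  | node w l r ihl ihr =>
    simp only [BinaryTree.numNodes] at h5 ht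
    set k := off + l.numNodes + 1 with hk
    have hcn := ρ.c_notMem
    have hvn := ρ.v_notMem
    simp only [List.mem_cons, List.not_mem_nil, or_false, not_or] at hcn hvn
    obtain ⟨hc0, hc5, hc6, hcv⟩ := hcn
    obtain ⟨hv0, hv5, hv6⟩ := hvn
    have hl : lifts E off (.node w l r) = lifts E k r ++ (chain E k off l ++ lifts E off l) := rfl
    rw [hl] at hc ⊢
    simp only [List.length_append] at hc ⊢
    obtain ⟨u₁, s₁, e₁, c₁, p₁, m₁, v₁, k₁⟩ := ihr k s (by omega) hL.2.2 hR.2.2 hd.2.2 (by omega)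
      hv (by omega)
    have n₁ := congrArg List.length m₁
    rw [List.length_append, length_emitted, length_emitted] at n₁
    have hd1 : ρ.Test s₁ k ↔ (off + 1, off + l.numNodes + r.numNodes + 1) ∈ E := (k₁.detects hd).1
    -- With `δ` both branches end in a store of the same form; for `δ = 0` the variable is
    -- overwritten by its own value.
    set δ := if (off + 1, off + l.numNodes + r.numNodes + 1) ∈ E then 1 else 0 with hδ
    obtain ⟨u₂, e₂, c₂⟩ : ∃ u, Exec B (.ite (ρ.testExpr 5)
        (.set ρ.v (.sub (.var ρ.v) (.const 1))) .skip) s₁ u (s₁.setVar ρ.v (s₁.var ρ.v - δ)) ∧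
        u ≤ 25 := by
      by_cases hE : (off + 1, off + l.numNodes + r.numNodes + 1) ∈ E
      · refine ⟨_, .ite_true (fun h => ?_) (.set_eq ?_ (by omega)), ?_⟩
        · rw [eval_testExpr, p₁, hd1] at h
          exact h hE
        · simp [Expr.eval, hδ, hE]
        · simp [testExpr, Expr.cost]
      · refine ⟨(ρ.testExpr 5).cost + 1 + 1, .ite_false ?_ ?_, ?_⟩
        · rw [eval_testExpr, p₁, hd1]
          exact hE
        · rw [hδ, if_neg hE, Nat.sub_zero, show s₁.setVar ρ.v (s₁.var ρ.v) = s₁ by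
            simp [Store.setVar]]
          exact .skip s₁
        · simp [testExpr, Expr.cost]
    set s₂ := (s₁.setVar ρ.v (s₁.var ρ.v - δ)).setVar 6 (rootKey off l) with hs₂
    have k₂ : ρ.Keeps s₁ s₂ := ((Frame.refl _ _ s₁).setVar (by simp) _).setVar (by simp) _
    have hLk : s₁.arr ρ.L k = rootKey off l := by
      rw [k₁.arr_eq (by simp)]; exact hL.1
    have hroot : rootKey off l ≤ off + l.numNodes := by
      cases l with
      | nil => simp [rootKey]
      | node _ a b => simp only [rootKey, BinaryTree.numNodes]; omega
    have e₂' : Exec B (.set 6 (.get ρ.L (.var 5))) (s₁.setVar ρ.v (s₁.var ρ.v - δ))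
        (Expr.cost (.get ρ.L (.var 5)) + 1) s₂ :=
      .set_eq (by simp [Expr.eval, Ne.symm hv5, p₁, hLk]) (by omega)
    have w₂ : s₂.var ρ.c = s₁.var ρ.c := by simp [hs₂, hc6, hcv]
    have m₂ : ρ.emitted s₂ = ρ.emitted s₁ := ρ.emitted_congr w₂ rfl rfl
    have k₁₂ : ρ.Keeps s s₂ := Frame.trans k₁ k₂
    obtain ⟨u₃, s₃, e₃, c₃, m₃, f₃⟩ := exec_chainLoop (ρ := ρ) (B := B) (p := k) (E := E) l off s₂
      (by simp [hs₂]) (by simp [hs₂, Ne.symm hv5, p₁])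
      (by rw [k₁₂.arr_eq (by simp)]; exact hR.2.1) (k₁₂.detects hd).2.1 (by omega) (by omega)
      (by omega)
    have n₃ := congrArg List.length m₃
    rw [List.length_append, length_emitted, length_emitted] at n₃
    have k₃ : ρ.Keeps s₂ s₃ := f₃.mono (by simp) (by simp)
    have x₃ : s₃.var 5 = k := by
      rw [f₃.1 5 (by simp [Ne.symm hc5])]
      simp [hs₂, Ne.symm hv5, p₁]
    have y₃ : s₃.var ρ.v = s₁.var ρ.v - δ := by
      rw [f₃.1 ρ.v (by simp [hv6, Ne.symm hcv])]
      simp [hs₂, hv6]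
    set s₄ := s₃.setVar 5 (k - 1) with hs₄
    have k₄ : ρ.Keeps s₃ s₄ := (Frame.refl _ _ s₃).setVar (by simp) _
    have e₄ : Exec B (.set 5 (.sub (.var 5) (.const 1))) s₃
        (Expr.cost (.sub (.var 5) (.const 1)) + 1) s₄ :=
      .set_eq (by simp [Expr.eval, x₃]) (by omega)
    have w₄ : s₄.var ρ.c = s₃.var ρ.c := by simp [hs₄, hc5]
    have y₄ : s₄.var ρ.v = s₁.var ρ.v - δ := by simp [hs₄, hv5, y₃]
    have m₄ : ρ.emitted s₄ = ρ.emitted s₃ := ρ.emitted_congr w₄ rfl rfl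
    have k₀₄ : ρ.Keeps s s₄ := Frame.trans k₁₂ (Frame.trans k₃ k₄)
    obtain ⟨u₅, s₅, e₅, c₅, p₅, m₅, v₅, k₅⟩ := ihl off s₄ (by simp [hs₄]; omega)
      (by rw [k₀₄.arr_eq (by simp)]; exact hL.2.1) (by rw [k₀₄.arr_eq (by simp)]; exact hR.2.1)
      (k₀₄.detects hd).2.1 (by omega) (by omega) (by omega)
    refine ⟨_, s₅, e₁.trans (.step (by simp only [Expr.eval]; omega)
      (.seq e₂ (.seq e₂' (.seq e₃ e₄))) e₅), ?_, p₅, ?_, ?_, Frame.trans k₀₄ k₅⟩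
    · simp only [BinaryTree.numNodes, Expr.cost]
      omega
    · rw [m₅, m₄, m₃, m₂, m₁]
      simp only [List.append_assoc]
    · have hdis : Disjoint (spans off l ∩ E) (spans k r ∩ E) :=
        (disjoint_spans off l r).mono Finset.inter_subset_left Finset.inter_subset_left
      have hcard : (spans off (.node w l r) ∩ E).card =
          δ + ((spans off l ∩ E).card + (spans k r ∩ E).card) := by
        rw [spans, hδ]
        split_ifs with hE
        · rw [Finset.insert_inter_of_mem hE, Finset.card_insert_of_notMem,
            Finset.union_inter_distrib_right, Finset.card_union_of_disjoint hdis, add_comm]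
          rw [Finset.mem_inter, Finset.mem_union]
          rintro ⟨h | h, -⟩
          · exact root_notMem_spans_left h
          · exact root_notMem_spans_right h
        · rw [Finset.insert_inter_of_notMem hE, Finset.union_inter_distrib_right,
            Finset.card_union_of_disjoint hdis, zero_add]
      omega

theorem exec_loop {B : ℕ} {E : Finset (ℕ × ℕ)} {t : BTree} {s : Store}
    (h0 : s.var 0 = t.numNodes) (hL : IsLeft (s.arr ρ.L) 0 t)
    (hR : IsRight (s.arr ρ.R) 0 t)
    (hd : ρ.Detects E s 0 t) (ht : t.numNodes ≤ B) (hv : s.var ρ.v ≤ B)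
    (hc0 : s.var ρ.c = 0) (hc : (lifts E 0 t).length ≤ B) (hE : E ⊆ spans 0 t) :
    ∃ u s', Exec B ρ.loop s u s' ∧
      u ≤ 70 * t.numNodes + 45 * (lifts E 0 t).length + 10 ∧
      ρ.emitted s' = lifts E 0 t ∧ s'.var ρ.v = s.var ρ.v - E.card ∧ ρ.Keeps s s' := by
  have hcn := ρ.c_notMem
  have hvn := ρ.v_notMem
  simp only [List.mem_cons, List.not_mem_nil, or_false, not_or] at hcn hvn
  have k₁ : ρ.Keeps s (s.setVar 5 t.numNodes) := (Frame.refl _ _ s).setVar (by simp) _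
  obtain ⟨u, s', e, c, p, m, v, k⟩ := iters_body (ρ := ρ) (B := B) (E := E) t 0
    (s.setVar 5 t.numNodes) (by simp) hL hR hd (by omega) (by simpa [hvn.2.1] using hv)
    (by simpa [hcn.2.1, hc0] using hc)
  refine ⟨_, s', .seq (.set_eq h0 ht) (e.exec p), ?_, ?_, ?_, Frame.trans k₁ k⟩
  · simp only [Expr.cost]; omega
  · rw [m, emitted]
    simp [hcn.2.1, hc0]
  · rw [v, Finset.inter_eq_right.2 hE]
    simp [hvn.2.1]

end EmitRegs

/-! ### The program -/

/-- The lifted nodes go straight into the direction array `4`: being keys, they are nonzero and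
hence read as right rotations. -/
def regsS : EmitRegs where
  L := 0
  R := 1
  lo := 6
  hi := 7
  lo' := 8
  hi' := 9
  P := 5
  X := 4
  c := 4
  v := 3
  P_ne_X := by decide
  arrays_notMem := by decide
  c_notMem := by decide
  v_notMem := by decide

/-- The lifts of `T` go to scratch arrays, since they must be reversed. Variable `8` is a dummy
counter that starts at `0`, so the common edges are subtracted only once from variable `3`. -/
def regsT : EmitRegs where
  L := 2
  R := 3
  lo := 8
  hi := 9
  lo' := 6
  hi' := 7
  P := 11
  X := 10
  c := 7
  v := 8
  P_ne_X := by decide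
  arrays_notMem := by decide
  c_notMem := by decide
  v_notMem := by decide

/-- Append to the output the left rotations at the keys in array `10`, last to first. -/
def popLoop : Cmd :=
  .while (.var 7) (.seq (.set 7 (.sub (.var 7) (.const 1)))
    (.seq (.put 5 (.var 4) (.get 10 (.var 7))) (.seq (.put 4 (.var 4) (.const 0))
      (.set 4 (.add (.var 4) (.const 1))))))

theorem exec_popLoop {B : ℕ} (m : ℕ) (s : Store) (h7 : s.var 7 = m)
    (hX : ∀ j < m, s.arr 10 j ≤ B) (h4 : s.var 4 + m ≤ B) :
    ∃ u s', Exec B popLoop s u s' ∧ u ≤ 30 * m + 2 ∧ s'.var 3 = s.var 3 ∧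
      outputRotations s' = outputRotations s ++
        ((List.range m).map fun j => (⟨.left, s.arr 10 j⟩ : Rotation)).reverse := by
  induction m generalizing s with
  | zero => exact ⟨_, s, .while_false h7, by simp [Expr.cost], rfl, by simp⟩
  | succ m ih =>
    set i := s.var 4 with hi
    set s₁ := (((s.setVar 7 m).setArr 5 i (s.arr 10 m)).setArr 4 i 0).setVar 4 (i + 1) with hs₁
    have m₁ : outputRotations s₁ = outputRotations s ++ [⟨.left, s.arr 10 m⟩] := by
      rw [outputRotations, show s₁.var 4 = i + 1 by simp [hs₁], List.range_succ, List.map_append,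
        outputRotations, ← hi]
      congr 1
      · refine List.map_congr_left fun j hj => ?_
        have hj' : j ≠ i := (List.mem_range.1 hj).ne
        simp [hs₁, hj']
      · simp [hs₁]
    obtain ⟨u₂, s₂, e₂, c₂, v₂, m₂⟩ := ih s₁ (by simp [hs₁])
      (fun j hj => by simpa [hs₁] using hX j (by omega)) (by simp [hs₁]; omega)
    refine ⟨_, s₂, .while_true (by simp [Expr.eval, h7]) (.seq (.set_eq (v := m) ?_ (by omega))
      (.seq (.put_eq (j := i) (v := s.arr 10 m) ?_ ?_ (by omega) (hX m (by omega)))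
      (.seq (.put_eq (j := i) (v := 0) ?_ ?_ (by omega) (by omega))
        (.set_eq (v := i + 1) ?_ (by omega))))) e₂, ?_, ?_, ?_⟩
    · simp [Expr.eval, h7]
    · simp [Expr.eval, hi]
    · simp [Expr.eval]
    · simp [Expr.eval, hi]
    · simp [Expr.eval]
    · simp [Expr.eval, hi]
    · simp only [Expr.cost]; omega
    · rw [v₂]; simp [hs₁]
    · rw [m₂, m₁, List.range_succ, List.map_append, List.reverse_append]
      simp [hs₁]

def program : Cmd :=
  .seq (firstLoop 0 6) (.seq (firstLoop 2 8) (.seq (lastLoop 1 7) (.seq (lastLoop 3 9)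
    (.seq (.set 3 (.sub (.var 0) (.const 1))) (.seq regsS.loop (.seq regsT.loop popLoop))))))

/-- The lower bound makes the entries of array `4` nonzero; the upper bound makes the keys copied by
`popLoop` fit in a word. -/
theorem Lifts.bounds {off : ℕ} {L : List (ℕ × ℕ)} {t t' : BTree} (h : Lifts off L t t') :
    ∀ q ∈ L, off < q.2 ∧ q.2 ≤ off + t.numNodes := by
  induction h with
  | nil t => simp
  | cons h _ ih =>
    obtain ⟨h1, h2, h3, h4, -⟩ := h.spec
    intro q hq
    rcases List.mem_cons.1 hq with rfl | hq
    · exact ⟨h2, by omega⟩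
    · rw [← h1]; exact ih q hq

theorem exec_program {S T : BTree} {n B : ℕ} (hn : 1 ≤ n) (hS : S.numNodes = n)
    (hT : T.numNodes = n) (hB : 2 * n ≤ B) :
    ∃ u s, Exec B program (inputStore S T) u s ∧ u ≤ 1000 * n ∧
      outputValue s = n - 1 - numCommonEdges S T ∧ outputRotations s = rotationPath S T := by
  set E := commonSpans S T with hE
  have hES : E ⊆ spans 0 S := commonSpans_subset_left S T
  have hET : E ⊆ spans 0 T := commonSpans_subset_right S T
  have lS := length_lifts_le hES (by omega) (root_notMem_commonSpans S T)
  have lT := length_lifts_le hET (by omega)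
    (by rw [hT, ← hS]; exact root_notMem_commonSpans S T)
  set s₀ := inputStore S T with hs₀
  have z₀ : s₀.var 0 = n := hS
  obtain ⟨u₁, s₁, e₁, c₁, f₁, o₁, i₁⟩ := exec_firstLoop (B := B) (L := 0) (lo := 6) (by decide)
    (t := S) (s := s₀) (by omega) (by omega) (isLeft_leftChild 0 S)
  have z₁ : s₁.var 0 = n := (f₁.1 0 (by decide)).trans z₀
  obtain ⟨u₂, s₂, e₂, c₂, f₂, o₂, i₂⟩ := exec_firstLoop (B := B) (L := 2) (lo := 8) (by decide)
    (t := T) (s := s₁) (by omega) (by omega)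
    (by rw [f₁.2 2 (by decide)]; exact isLeft_leftChild 0 T)
  have z₂ : s₂.var 0 = n := (f₂.1 0 (by decide)).trans z₁
  obtain ⟨u₃, s₃, e₃, c₃, f₃, o₃, i₃⟩ := exec_lastLoop (B := B) (R := 1) (hi := 7) (by decide)
    (t := S) (s := s₂) (by omega) (by omega)
    (by rw [f₂.2 1 (by decide), f₁.2 1 (by decide)]; exact isRight_rightChild 0 S)
  have z₃ : s₃.var 0 = n := (f₃.1 0 (by decide)).trans z₂
  obtain ⟨u₄, s₄, e₄, c₄, f₄, o₄, i₄⟩ := exec_lastLoop (B := B) (R := 3) (hi := 9) (by decide)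
    (t := T) (s := s₃) (by omega) (by omega)
    (by rw [f₃.2 3 (by decide), f₂.2 3 (by decide), f₁.2 3 (by decide)]
        exact isRight_rightChild 0 T)
  have z₄ : s₄.var 0 = n := (f₄.1 0 (by decide)).trans z₃
  set s₅ := s₄.setVar 3 (n - 1) with hs₅
  have f₀₅ : Frame [3, 5] [6, 7, 8, 9] s₀ s₅ :=
    ((((f₁.mono (by decide) (by decide)).trans (f₂.mono (by decide) (by decide))).trans
      (f₃.mono (by decide) (by decide))).trans (f₄.mono (by decide) (by decide))).setVar
      (by decide) _
  have z₅ : s₅.var 0 = n := (f₀₅.1 0 (by decide)).trans z₀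
  have j₁ : s₅.arr 6 = s₁.arr 6 := ((f₄.2 6 (by decide)).trans (f₃.2 6 (by decide))).trans
    (f₂.2 6 (by decide))
  have j₂ : s₅.arr 8 = s₂.arr 8 := (f₄.2 8 (by decide)).trans (f₃.2 8 (by decide))
  have j₃ : s₅.arr 7 = s₃.arr 7 := f₄.2 7 (by decide)
  have j₄ : s₅.arr 9 = s₄.arr 9 := rfl
  have dS : regsS.Detects E s₅ 0 S := by
    show Detects E (s₅.arr 6) (s₅.arr 7) (s₅.arr 8) (s₅.arr 9) 0 S
    rw [j₁, j₂, j₃, j₄]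
    refine detects i₁ i₃ i₂ i₄ ?_ ?_ (by omega) (by rw [hE, commonSpans, hS, hT])
    -- The sentinel entries are never written and keep the initial value `0`.
    · rw [o₂ _ (by omega), f₁.2 8 (by decide)]; rfl
    · rw [o₄ _ (by omega), f₃.2 9 (by decide), f₂.2 9 (by decide), f₁.2 9 (by decide)]; rfl
  have dT : regsT.Detects E s₅ 0 T := by
    show Detects E (s₅.arr 8) (s₅.arr 9) (s₅.arr 6) (s₅.arr 7) 0 T
    rw [j₁, j₂, j₃, j₄]
    refine detects i₂ i₄ i₁ i₃ ?_ ?_ (by omega) (by rw [hE, commonSpans, Finset.inter_comm])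
    · rw [o₁ _ (by omega)]; rfl
    · rw [o₃ _ (by omega), f₂.2 7 (by decide), f₁.2 7 (by decide)]; rfl
  obtain ⟨u₆, s₆, e₆, c₆, m₆, v₆, k₆⟩ := EmitRegs.exec_loop (ρ := regsS) (B := B) (E := E) (t := S)
    (s := s₅) (by omega) (by rw [f₀₅.2 _ (by decide)]; exact isLeft_leftChild 0 S)
    (by rw [f₀₅.2 _ (by decide)]; exact isRight_rightChild 0 S) dS (by omega)
    (by show (s₄.setVar 3 (n - 1)).var 3 ≤ B; simp; omega)
    (by rw [f₀₅.1 _ (by decide)]; rfl) (by omega) hES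
  have g₆ : Frame [3, 4, 5, 6] [4, 5] s₅ s₆ := Frame.mono k₆ (by decide) (by decide)
  obtain ⟨u₇, s₇, e₇, c₇, m₇, v₇, k₇⟩ := EmitRegs.exec_loop (ρ := regsT) (B := B) (E := E) (t := T)
    (s := s₆) (by rw [g₆.1 0 (by decide)]; omega)
    (by rw [g₆.2 _ (by decide), f₀₅.2 _ (by decide)]; exact isLeft_leftChild 0 T)
    (by rw [g₆.2 _ (by decide), f₀₅.2 _ (by decide)]; exact isRight_rightChild 0 T)
    (by
      show Detects E (s₆.arr 8) (s₆.arr 9) (s₆.arr 6) (s₆.arr 7) 0 T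
      rw [g₆.2 6 (by decide), g₆.2 7 (by decide), g₆.2 8 (by decide), g₆.2 9 (by decide)]
      exact dT)
    (by omega)
    (by rw [g₆.1 _ (by decide), f₀₅.1 _ (by decide)]; exact Nat.zero_le _)
    (by rw [g₆.1 _ (by decide), f₀₅.1 _ (by decide)]; rfl) (by omega) hET
  have g₇ : Frame [5, 6, 7, 8] [10, 11] s₆ s₇ := Frame.mono k₇ (by decide) (by decide)
  have m₆' : regsS.emitted s₇ = lifts E 0 S := by
    rw [← m₆]
    exact EmitRegs.emitted_congr _ (g₇.1 _ (by decide)) (g₇.2 _ (by decide)) (g₇.2 _ (by decide))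
  have a₇ : s₇.var 4 = (lifts E 0 S).length := by rw [← m₆', EmitRegs.length_emitted]; rfl
  have b₇ : s₇.var 7 = (lifts E 0 T).length := by rw [← m₇, EmitRegs.length_emitted]; rfl
  have x₇ : ∀ j < (lifts E 0 T).length, s₇.arr 10 j ≤ B := by
    intro j hj
    have hmem : (s₇.arr 11 j, s₇.arr 10 j) ∈ regsT.emitted s₇ :=
      List.mem_map.2 ⟨j, List.mem_range.2 (b₇ ▸ hj), rfl⟩
    rw [m₇] at hmem
    have := ((lifts_comb E T 0).1.bounds _ hmem).2
    dsimp only at this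
    omega
  obtain ⟨u₈, s₈, e₈, c₈, v₈, m₈⟩ := exec_popLoop (B := B) _ s₇ b₇ x₇ (by omega)
  refine ⟨_, s₈, .seq e₁ (.seq e₂ (.seq e₃ (.seq e₄ (.seq
    (.set_eq (v := n - 1) (by simp [Expr.eval, z₄]) (by omega)) (.seq e₆ (.seq e₇ e₈)))))),
    ?_, ?_, ?_⟩
  · simp only [Expr.cost]
    omega
  · rw [outputValue, v₈, g₇.1 3 (by decide), numCommonEdges_eq S T (by omega)]
    have : s₅.var regsS.v = n - 1 := by
      show (s₄.setVar 3 (n - 1)).var 3 = n - 1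
      simp
    rw [← this]
    exact v₆
  · rw [m₈, rotationPath]
    congr 1
    · rw [← hE, ← m₆', EmitRegs.emitted, List.map_map, outputRotations]
      refine List.map_congr_left fun j hj => ?_
      have hmem : (s₇.arr 5 j, s₇.arr 4 j) ∈ regsS.emitted s₇ := List.mem_map.2 ⟨j, hj, rfl⟩
      rw [m₆'] at hmem
      have := ((lifts_comb E S 0).1.bounds _ hmem).1
      dsimp only at this
      -- The stored value is a positive key, so the direction is read as right.
      rw [if_neg (by omega)]
      rfl
    · rw [← hE, ← List.map_reverse, ← m₇, EmitRegs.length_emitted, EmitRegs.emitted,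
        ← List.map_reverse, List.map_map]
      rfl

end RotDist

theorem mainTheorem2 :
    ∃ (P : RotDist.Cmd) (C : ℕ), ∀ (n : ℕ) (S T : RotDist.BTree),
      1 ≤ n → S.numNodes = n → T.numNodes = n →
      ∃ (t : ℕ) (s : RotDist.Store),
        RotDist.Exec (C * n) P (RotDist.inputStore S T) t s ∧
        t ≤ C * n ∧
        RotDist.outputValue s + RotDist.numCommonEdges S T + 1 = n ∧
        (RotDist.outputValue s : ℕ∞) ≤ RotDist.rotationDist S T ∧
        RotDist.rotationDist S T ≤ 2 * (RotDist.outputValue s : ℕ∞) ∧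
        RotDist.applyRotations (RotDist.outputRotations s) S = some T ∧
        (RotDist.outputRotations s).length ≤ 2 * RotDist.outputValue s := by
  refine ⟨RotDist.program, 1000, fun n S T hn hS hT => ?_⟩
  obtain ⟨t, s, he, ht, hv, hr⟩ := RotDist.exec_program (B := 1000 * n) hn hS hT (by omega)
  have hST : S.numNodes = T.numNodes := hS.trans hT.symm
  have lS := RotDist.length_lifts_le (RotDist.commonSpans_subset_left S T) (by omega)
    (RotDist.root_notMem_commonSpans S T)
  have lT := RotDist.length_lifts_le (RotDist.commonSpans_subset_right S T) (by omega)
    (hST ▸ RotDist.root_notMem_commonSpans S T)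
  rw [← RotDist.numCommonEdges_eq S T hST] at lS lT
  -- The machine computes a truncated difference; `lS` gives `e + 1 ≤ n`, so nothing is cut off.
  have hv' : RotDist.outputValue s + RotDist.numCommonEdges S T + 1 = n := by omega
  have hp := RotDist.applyRotations_rotationPath hST
  have hl : (RotDist.rotationPath S T).length ≤ 2 * RotDist.outputValue s := by
    simp only [RotDist.rotationPath, List.length_append, List.length_map, List.length_reverse]
    omega
  refine ⟨t, s, he, ht, hv', RotDist.le_rotationDist hST (by omega) (by omega), ?_,
    hr ▸ hp, hr ▸ hl⟩
  calc RotDist.rotationDist S T ≤ ((RotDist.rotationPath S T).length : ℕ∞) :=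
        iInf_le (fun l : {l : List RotDist.Rotation // RotDist.applyRotations l S = some T} =>
          (l.1.length : ℕ∞)) ⟨_, hp⟩
    _ ≤ 2 * (RotDist.outputValue s : ℕ∞) := by exact_mod_cast hl
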